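/- Let $\gamma>0$ be real. For a positive integer $N$ and real $t>0$ put $$W_\gamma(N,t)=\frac{\displaystyle\int_{\mathbb R^N}|V(\lambda)|^{2\gamma}\prod_{j=1}^N e^{-i\gamma\lambda_j/\sqrt t}\,(1-i\sqrt t\,\lambda_j)^{-\gamma/t}\,d\lambda}{\displaystyle\int_{\mathbb R^N}|V(\lambda)|^{2\gamma}e^{-\frac{\gamma}{2}(\lambda_1^2+\cdots+\lambda_N^2)}\,d\lambda},\qquad V(\lambda)=\prod_{1\le i<j\le N}(\lambda_j-\lambda_i),$$ where powers and logarithms are principal. Let $B_n$ be the Bernoulli numbers, $\frac{t}{e^t-1}=\sum_{n\ge0}B_n\frac{t^n}{n!}$. For each $N\ge1$ both integrands are absolutely integrable for all sufficiently small $t>0$ (the denominator does not depend on $t$), the denominator is positive, and $W_\gamma(N,t)\ne0$ for all sufficiently small $t>0$. Moreover there is exactly one formal power series in $t$ with coefficients that are polynomials in $x$ (over $\mathbb C$), denoted $\log W_\gamma(x,t)$, such that for every positive integer $N$ the substitution $x=N$ gives the asymptotic expansion of the function $\log W_\gamma(N,t)$ as $t\to0^+$ (that is, as $1/t\to+\infty$;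 a function $f(t)$ has the asymptotic expansion $\sum_k c_kt^k$ if $f(t)-\sum_{k<n}c_kt^k=O(t^n)$ for every $n\ge0$). This series is $$\log W_\gamma (x,t)=-\gamma x\sum_{k\ge1}\frac{B_{2k}t^{2k-1}}{2k(2k-1)}+\sum_{\delta\ge1}\frac{t^\delta}{\delta(\delta+1)}\sum_{r=1}^{\delta+1}\binom{\delta+1}{r}B_{\delta+1-r}\left(\frac{x^r(-1)^{\delta+1-r}}{\gamma^{\delta-r}}-\sum_{m=1}^{r+1}\binom{r+1}{m}\frac{B_{r+1-m}}{r+1}\,\frac{x^m}{\gamma^{r-m}}(-1)^{\delta-m}\right).$$ -/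

import Mathlib

open Filter Topology MeasureTheory

noncomputable section

namespace BetaEnsemble

/-- The Vandermonde product `V(v) = ∏_{i < j} (v_j - v_i)`. -/
def vand {N : ℕ} (v : Fin N → ℝ) : ℝ :=
  ∏ i : Fin N, ∏ j ∈ Finset.Ioi i, (v j - v i)

/-- The integrand of the numerator:
`|V(v)|^{2γ} ∏_j e^{-iγ v_j/√t} (1 - i√t v_j)^{-γ/t}`.  The complex power is the principal one;
its base has real part `1`. -/
def numIntegrand (γ : ℝ) (N : ℕ) (t : ℝ) (v : Fin N → ℝ) : ℂ :=
  ((|vand v| ^ (2 * γ) : ℝ) : ℂ) *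
    ∏ j : Fin N,
      (Complex.exp (-(Complex.I * (γ : ℂ) * (v j : ℂ) / ((√t : ℝ) : ℂ))) *
        (1 - Complex.I * ((√t : ℝ) : ℂ) * (v j : ℂ)) ^ (-((γ : ℂ) / (t : ℂ))))

/-- The integrand of the denominator: `|V(v)|^{2γ} e^{-γ p₂(v)/2}` with `p₂(v) = ∑ v_j²`. -/
def denIntegrand (γ : ℝ) (N : ℕ) (v : Fin N → ℝ) : ℝ :=
  |vand v| ^ (2 * γ) * Real.exp (-(γ * ∑ j : Fin N, v j ^ 2) / 2)

/-- The normalized integral `W_γ(N, t)`, with Lebesgue measure on `ℝ^N`. -/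
def W (γ : ℝ) (N : ℕ) (t : ℝ) : ℂ :=
  (∫ v : Fin N → ℝ, numIntegrand γ N t v) / ((∫ v : Fin N → ℝ, denIntegrand γ N v : ℝ) : ℂ)

/-- `f(t) ~ ∑_{k ≥ 0} c_k t^k` as an asymptotic expansion for `t → 0⁺`, that is, `1/t → +∞`. -/
def HasAsympExpansion (f : ℝ → ℂ) (c : ℕ → ℂ) : Prop :=
  ∀ n : ℕ, (fun t : ℝ => f t - ∑ k ∈ Finset.range n, c k * (t : ℂ) ^ k)
    =O[𝓝[>] (0 : ℝ)] (fun t : ℝ => t ^ n)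

/-- The formal power series `L = ∑_k L_k(x) t^k` with polynomial coefficients in `x` presents
`log W_γ(x, t)`: putting `x = N` gives, for every positive integer `N`, the asymptotic expansion
of the function `t ↦ log W_γ(N, t)`. -/
def IsLogW (γ : ℝ) (L : PowerSeries (Polynomial ℂ)) : Prop :=
  ∀ N : ℕ, 1 ≤ N →
    HasAsympExpansion (fun t => Complex.log (W γ N t))
      (fun k => (PowerSeries.coeff k L).eval (N : ℂ))

end BetaEnsemble

end

/-! Put `s = γ / t` and `u = √t v`. The numerator becomes, up to a power of `t`, the integral `Z(p,
s)` of `|V(u)| ^ (2γ) ∏ e ^ (-i p u_j) (1 - i u_j) ^ (-s)` at `p = s`. No closed form of `Z` is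
needed, only two relations, both from Aomoto's method. Integrating by parts in `u_a` against `∏_{j ∈
S ∪ {a}} (1 - i u_j)` and symmetrizing gives, for `a ∉ S`, `p ⟨S ∪ {a}⟩ = (s - 1 - γ (N - |S| - 1))
⟨S⟩` (`integral_ensemble_linProd_insert`). Iterated up to the full set, this shifts the exponent `s`
by one (`pow_mul_partitionFn`); for singletons it is a differential equation in `p`, so `Z` is
explicit in `p` (`partitionFn_eq_exp_mul`).

Together they give `log W(γ/(s+1)) - log W(γ/s)` as the sum over `j < N` of the increments of `log
(s ^ (s + a - 1/2) e ^ (-s) / Γ(s + a))` at `a = -γ j` (`W_div_add_one`). Dominated convergence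
gives `W → 1` (`tendsto_W`), which fixes the constant and replaces the Selberg-type evaluation of
the denominator. The truncated Stirling series, with Bernoulli polynomial coefficients, solves the
same difference equation up to `O(s ^ (-n-1))` (`isBigO_stirling_sub`). A function that vanishes at
infinity and has increments of that order is `O(s ^ (-n))`, so `log W` has the summed Stirling
series as its expansion (`isBigO_sub_sum_stirlingCoeff`).

It remains to sum `B_{δ+1}(-γ j)` over `j < N` as a polynomial in `N` of the stated form. This goes
by induction on `N`: binomial convolution with the Bernoulli numbers inverts the averaging of a
polynomial over an interval (`logWCoeff_natCast`). Uniqueness holds because an asymptotic expansion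
determines its coefficients and a polynomial is determined by its values at the positive integers.
-/

namespace BetaEnsemble

/-! ### Identities for Bernoulli numbers and polynomials -/

section Bernoulli

open Polynomial Finset

theorem aeval_bernoulli {A : Type*} [CommRing A] [Algebra ℚ A] (n : ℕ) (z : A) :
    aeval z (Polynomial.bernoulli n) =
      ∑ i ∈ range (n + 1), algebraMap ℚ A (_root_.bernoulli (n - i)) * (n.choose i : A) * z ^ i := by
  rw [Polynomial.bernoulli_def, map_sum]
  refine sum_congr rfl fun i _ => ?_
  rw [aeval_monomial, map_mul, map_natCast]

/-- The generating function of the values at `z` is `X e^{zX} / (e^X - 1)`, so translation by `c`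
multiplies it by `e^{cX}`. Power series over a field form a domain, so it suffices to compare after
multiplication by `e^X - 1`. -/
theorem aeval_bernoulli_add {K : Type*} [Field K] [CharZero K] (n : ℕ) (w c : K) :
    aeval (w + c) (Polynomial.bernoulli n) =
      ∑ k ∈ range (n + 1), (n.choose k : K) * aeval w (Polynomial.bernoulli k) * c ^ (n - k) := by
  have key : (PowerSeries.mk fun n => aeval (w + c) ((1 / n.factorial : ℚ) • Polynomial.bernoulli n)) =
      (PowerSeries.mk fun n => aeval w ((1 / n.factorial : ℚ) • Polynomial.bernoulli n)) *
        PowerSeries.rescale c (PowerSeries.exp K) := by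
    have hne : PowerSeries.exp K - 1 ≠ 0 := by
      intro h
      have := congrArg (PowerSeries.coeff 1) h
      simp [PowerSeries.coeff_exp, PowerSeries.coeff_one] at this
    apply mul_right_cancel₀ hne
    rw [Polynomial.bernoulli_generating_function, mul_right_comm,
      Polynomial.bernoulli_generating_function, mul_assoc, PowerSeries.exp_mul_exp_eq_exp_add]
  have h := congrArg (PowerSeries.coeff n) key
  rw [PowerSeries.coeff_mul, Finset.Nat.sum_antidiagonal_eq_sum_range_succ_mk] at h
  have hs : ∀ (z : K) (k : ℕ), aeval z ((1 / k.factorial : ℚ) • Polynomial.bernoulli k) =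
      (k.factorial : K)⁻¹ * aeval z (Polynomial.bernoulli k) := fun z k => by
    rw [map_smul, Algebra.smul_def, map_div₀, map_one, map_natCast, one_div]
  simp only [PowerSeries.coeff_mk, PowerSeries.coeff_rescale, PowerSeries.coeff_exp, hs, map_div₀,
    map_one, map_natCast] at h
  have hn : (n.factorial : K) ≠ 0 := by exact_mod_cast n.factorial_ne_zero
  rw [inv_mul_eq_iff_eq_mul₀ hn, Finset.mul_sum] at h
  rw [h]
  refine sum_congr rfl fun k hk => ?_
  have hk' : k ≤ n := by simpa [Nat.lt_succ_iff] using hk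
  rw [Nat.cast_choose K hk']
  field_simp

/-- Bernoulli numbers are inverse to the sequence `1 / (q + 1)` under binomial convolution. Since
`C(m, q) / (q + 1) = C(m+1, q+1) / (m+1)`, reversing the sum gives the defining recurrence. -/
theorem sum_choose_mul_bernoulli_div_succ (m : ℕ) :
    ∑ q ∈ range (m + 1), (m.choose q : ℚ) * _root_.bernoulli (m - q) / (q + 1) =
      if m = 0 then 1 else 0 := by
  have h := _root_.sum_bernoulli (m + 1)
  rw [← sum_range_reflect] at h
  have h2 : ∑ q ∈ range (m + 1), (m.choose q : ℚ) * _root_.bernoulli (m - q) / (q + 1) =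
      (1 / (m + 1)) * ∑ j ∈ range (m + 1), ((m + 1).choose (m + 1 - 1 - j) : ℚ) *
        _root_.bernoulli (m + 1 - 1 - j) := by
    rw [mul_sum]
    refine sum_congr rfl fun q hq => ?_
    have hq' : q ≤ m := by simpa [Nat.lt_succ_iff] using hq
    have h3 : ((m + 1 : ℕ) : ℚ) * (m.choose q : ℚ) = ((m + 1).choose (q + 1) : ℚ) * ((q + 1 : ℕ) : ℚ) := by
      exact_mod_cast Nat.add_one_mul_choose_eq m q
    have h4 : (m + 1).choose (m + 1 - 1 - q) = (m + 1).choose (q + 1) := by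
      rw [← Nat.choose_symm (by omega : q + 1 ≤ m + 1)]
      congr 1; omega
    rw [h4, Nat.add_sub_cancel]
    push_cast at h3
    have : (m : ℚ) + 1 ≠ 0 := by positivity
    field_simp
    linear_combination h3 * _root_.bernoulli (m - q)
  rw [h2, h]
  rcases eq_or_ne m 0 with rfl | hm
  · simp
  · simp [hm]

theorem aeval_bernoulli_add_sub {K : Type*} [Field K] [CharZero K] (r : ℕ) (w c : K) :
    (aeval (w + c) (Polynomial.bernoulli (r + 1)) - aeval w (Polynomial.bernoulli (r + 1))) /
        ((r : K) + 1) =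
      ∑ k ∈ range (r + 1), (r.choose k : K) / ((r - k : ℕ) + 1) *
        aeval w (Polynomial.bernoulli k) * c ^ (r - k + 1) := by
  rw [aeval_bernoulli_add, sum_range_succ]
  simp only [Nat.choose_self, Nat.cast_one, one_mul, Nat.sub_self, pow_zero, mul_one, add_sub_cancel_right]
  rw [sum_div]
  refine sum_congr rfl fun k hk => ?_
  have hk' : k ≤ r := by simpa [Nat.lt_succ_iff] using hk
  have h3 : ((r + 1).choose k : K) * ((r + 1 - k : ℕ) : K) = ((r + 1 : ℕ) : K) * (r.choose k : K) := by
    have := Nat.choose_mul_succ_eq r k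
    have h : (r + 1).choose k * (r + 1 - k) = (r + 1) * r.choose k := by
      rw [← this, mul_comm]
    exact_mod_cast h
  have e : r + 1 - k = r - k + 1 := by omega
  rw [e] at h3 ⊢
  push_cast at h3
  have h1 : (r : K) + 1 ≠ 0 := by exact_mod_cast Nat.succ_ne_zero r
  have h2 : ((r - k : ℕ) : K) + 1 ≠ 0 := by exact_mod_cast Nat.succ_ne_zero (r - k)
  field_simp
  linear_combination (aeval w (Polynomial.bernoulli k) * c ^ (r - k + 1)) * h3

/-- The Bernoulli transform of a difference quotient with step `c` of Bernoulli polynomials. -/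
theorem sum_bernoulli_mul_aeval_bernoulli_sub {K : Type*} [Field K] [CharZero K] (n : ℕ) (w c : K)
    (hc : c ≠ 0) :
    ∑ r ∈ range (n + 1), (n.choose r : K) * algebraMap ℚ K (_root_.bernoulli (n - r)) / c ^ r *
      ((aeval (w + c) (Polynomial.bernoulli (r + 1)) - aeval w (Polynomial.bernoulli (r + 1))) /
        ((r : K) + 1)) =
      c / c ^ n * aeval w (Polynomial.bernoulli n) := by
  have h1 : ∀ r ∈ range (n + 1), (n.choose r : K) * algebraMap ℚ K (_root_.bernoulli (n - r)) / c ^ r *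
      ((aeval (w + c) (Polynomial.bernoulli (r + 1)) - aeval w (Polynomial.bernoulli (r + 1))) /
        ((r : K) + 1)) = ∑ k ∈ range (r + 1), (n.choose k : K) * (c / c ^ k) *
          aeval w (Polynomial.bernoulli k) *
          (((n - k).choose (r - k) : K) * algebraMap ℚ K (_root_.bernoulli ((n - k) - (r - k))) /
            ((r - k : ℕ) + 1)) := by
    intro r hr
    have hr' : r ≤ n := by simpa [Nat.lt_succ_iff] using hr
    rw [aeval_bernoulli_add_sub, mul_sum]
    refine sum_congr rfl fun k hk => ?_
    have hk' : k ≤ r := by simpa [Nat.lt_succ_iff] using hk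
    have h3 : (n.choose r : K) * (r.choose k : K) = (n.choose k : K) * ((n - k).choose (r - k) : K) := by
      exact_mod_cast Nat.choose_mul hk'
    have e : n - k - (r - k) = n - r := by omega
    have e2 : c ^ r = c ^ k * c ^ (r - k) := by rw [← pow_add]; congr 1; omega
    have h2 : ((r - k : ℕ) : K) + 1 ≠ 0 := by exact_mod_cast Nat.succ_ne_zero (r - k)
    rw [e, e2, pow_succ]
    field_simp
    linear_combination (algebraMap ℚ K (_root_.bernoulli (n - r)) * aeval w (Polynomial.bernoulli k)) * h3
  rw [sum_congr rfl h1]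
  have h5 : ∑ r ∈ range (n + 1), ∑ k ∈ range (r + 1), (n.choose k : K) * (c / c ^ k) *
          aeval w (Polynomial.bernoulli k) *
          (((n - k).choose (r - k) : K) * algebraMap ℚ K (_root_.bernoulli ((n - k) - (r - k))) /
            ((r - k : ℕ) + 1)) =
      ∑ k ∈ range (n + 1), (n.choose k : K) * (c / c ^ k) *
          aeval w (Polynomial.bernoulli k) * ∑ q ∈ range (n - k + 1),
          (((n - k).choose q : K) * algebraMap ℚ K (_root_.bernoulli ((n - k) - q)) /
            ((q : K) + 1)) := by
    rw [Finset.sum_comm' (t' := range (n + 1)) (s' := fun k => Finset.Ico k (n + 1))]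
    · refine sum_congr rfl fun k hk => ?_
      have hk' : k ≤ n := by simpa [Nat.lt_succ_iff] using hk
      rw [mul_sum, Finset.sum_Ico_eq_sum_range]
      have e : n + 1 - k = n - k + 1 := by omega
      rw [e]
      refine sum_congr rfl fun q _ => ?_
      rw [Nat.add_sub_cancel_left]
    · intro x y
      simp only [mem_range, mem_Ico]
      omega
  -- The inner convolution vanishes unless `n - k = 0`, so only `k = n` survives.
  rw [h5, sum_range_succ, sum_eq_zero]
  · simp
  · intro k hk
    have hk' : k < n := by simpa using hk
    have := congrArg (algebraMap ℚ K) (sum_choose_mul_bernoulli_div_succ (n - k))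
    rw [if_neg (by omega), map_sum, map_zero] at this
    simp only [map_div₀, map_mul, map_natCast, map_add, map_one] at this
    rw [this, mul_zero]

end Bernoulli

/-! ### The stated coefficients as sums of Bernoulli polynomial values -/

section Coefficients

open Polynomial Finset

theorem sum_Icc_choose_mul_bernoulli (z : ℂ) (n : ℕ) :
    ∑ m ∈ Icc 1 n, (n.choose m : ℂ) * (_root_.bernoulli (n - m) : ℂ) * z ^ m =
      aeval z (Polynomial.bernoulli n) - (_root_.bernoulli n : ℂ) := by
  rw [aeval_bernoulli, Finset.range_eq_Ico, Finset.sum_eq_sum_Ico_succ_bot (Nat.succ_pos n)]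
  simp only [Nat.sub_zero, Nat.choose_zero_right, Nat.cast_one, mul_one, pow_zero,
    eq_ratCast, add_sub_cancel_left]
  refine sum_congr rfl fun m _ => ?_
  ring

/-- The value at `x` of the coefficient of `t ^ δ` in the expansion of `log W`. -/
noncomputable def logWCoeff (g : ℂ) (δ : ℕ) (x : ℂ) : ℂ :=
  -(g * x) * (if Odd δ then (_root_.bernoulli (δ + 1) : ℂ) / (((δ : ℂ) + 1) * (δ : ℂ)) else 0) +
    1 / ((δ : ℂ) * ((δ : ℂ) + 1)) * ∑ r ∈ Icc 1 (δ + 1),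
      ((δ + 1).choose r : ℂ) * (_root_.bernoulli (δ + 1 - r) : ℂ) *
        ((-1 : ℂ) ^ (δ + 1 - r) / g ^ ((δ : ℤ) - (r : ℤ)) * x ^ r -
          ∑ m ∈ Icc 1 (r + 1), ((r + 1).choose m : ℂ) *
            ((_root_.bernoulli (r + 1 - m) : ℂ) / ((r : ℂ) + 1)) *
              (1 / g ^ ((r : ℤ) - (m : ℤ))) * (-1 : ℂ) ^ ((δ : ℤ) - (m : ℤ)) * x ^ m)

/-- The signs and powers of `g` combine with `x ^ m` into `(-(g x)) ^ m`, so each sum over powers of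
`x` is a Bernoulli polynomial at `-(g x)` without its constant term. The separate term linear in `x`
supplies the index `r = 0` of the outer sum. -/
theorem logWCoeff_eq (g : ℂ) (hg : g ≠ 0) (δ : ℕ) (hδ : 1 ≤ δ) (x : ℂ) :
    logWCoeff g δ x = (-1) ^ δ / ((δ : ℂ) * ((δ : ℂ) + 1)) *
      (-((aeval (-(g * x)) (Polynomial.bernoulli (δ + 1)) - (_root_.bernoulli (δ + 1) : ℂ)) / g ^ δ) -
        ∑ r ∈ range (δ + 1 + 1), ((δ + 1).choose r : ℂ) *
          algebraMap ℚ ℂ (_root_.bernoulli (δ + 1 - r)) / g ^ r *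
          ((aeval (-(g * x)) (Polynomial.bernoulli (r + 1)) - (_root_.bernoulli (r + 1) : ℂ)) /
            ((r : ℂ) + 1))) := by
  have hd : (δ : ℂ) ≠ 0 := by exact_mod_cast (by omega : δ ≠ 0)
  have hd1 : (δ : ℂ) + 1 ≠ 0 := by exact_mod_cast Nat.succ_ne_zero δ
  have inner : ∀ r, ∑ m ∈ Icc 1 (r + 1), ((r + 1).choose m : ℂ) *
            ((_root_.bernoulli (r + 1 - m) : ℂ) / ((r : ℂ) + 1)) *
              (1 / g ^ ((r : ℤ) - (m : ℤ))) * (-1 : ℂ) ^ ((δ : ℤ) - (m : ℤ)) * x ^ m =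
      (-1) ^ δ / g ^ r * ((aeval (-(g * x)) (Polynomial.bernoulli (r + 1)) -
        (_root_.bernoulli (r + 1) : ℂ)) / ((r : ℂ) + 1)) := by
    intro r
    rw [← sum_Icc_choose_mul_bernoulli, sum_div, mul_sum]
    refine sum_congr rfl fun m _ => ?_
    rw [zpow_sub₀ hg, zpow_sub₀ (by norm_num : (-1 : ℂ) ≠ 0)]
    simp only [zpow_natCast]
    have h1 : (-1 : ℂ) ^ m * (-1) ^ m = 1 := by rw [← mul_pow]; simp
    have h2 : ((-1 : ℂ) ^ m)⁻¹ = (-1) ^ m := inv_eq_of_mul_eq_one_left h1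
    have e : (-(g * x)) ^ m = (-1) ^ m * (g ^ m * x ^ m) := by rw [neg_pow, mul_pow]
    rw [e, div_eq_mul_inv ((-1 : ℂ) ^ δ) ((-1) ^ m), h2]
    have h3 : (r : ℂ) + 1 ≠ 0 := by exact_mod_cast Nat.succ_ne_zero r
    field_simp
  have first : ∑ r ∈ Icc 1 (δ + 1), ((δ + 1).choose r : ℂ) * (_root_.bernoulli (δ + 1 - r) : ℂ) *
        ((-1 : ℂ) ^ (δ + 1 - r) / g ^ ((δ : ℤ) - (r : ℤ)) * x ^ r) =
      -((-1) ^ δ * ((aeval (-(g * x)) (Polynomial.bernoulli (δ + 1)) -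
        (_root_.bernoulli (δ + 1) : ℂ)) / g ^ δ)) := by
    rw [← sum_Icc_choose_mul_bernoulli, sum_div, mul_sum, ← sum_neg_distrib]
    refine sum_congr rfl fun r hr => ?_
    have hr' : r ≤ δ + 1 := (mem_Icc.1 hr).2
    rw [zpow_sub₀ hg]
    simp only [zpow_natCast]
    have h1 : (-1 : ℂ) ^ r * (-1) ^ r = 1 := by rw [← mul_pow]; simp
    have h2 : (-1 : ℂ) ^ (δ + 1 - r) = -((-1) ^ δ * (-1) ^ r) := by
      have : (-1 : ℂ) ^ (δ + 1 - r) * (-1) ^ r = (-1) ^ (δ + 1) := by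
        rw [← pow_add]; congr 1; omega
      rw [pow_succ] at this
      linear_combination (-1 : ℂ) ^ r * this - (-1 : ℂ) ^ (δ + 1 - r) * h1
    have e : (-(g * x)) ^ r = (-1) ^ r * (g ^ r * x ^ r) := by rw [neg_pow, mul_pow]
    rw [e, h2]
    field_simp
  unfold logWCoeff
  simp only [mul_sub, sum_sub_distrib, inner]
  simp only [← mul_sub]
  rw [first, range_eq_Ico, Finset.sum_eq_sum_Ico_succ_bot (Nat.succ_pos (δ + 1))]
  have hI : Ico (0 + 1) (δ + 1).succ = Icc 1 (δ + 1) := rfl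
  rw [hI]
  have hs : ∑ r ∈ Icc 1 (δ + 1), ((δ + 1).choose r : ℂ) * (_root_.bernoulli (δ + 1 - r) : ℂ) *
      ((-1) ^ δ / g ^ r * ((aeval (-(g * x)) (Polynomial.bernoulli (r + 1)) -
        (_root_.bernoulli (r + 1) : ℂ)) / ((r : ℂ) + 1))) =
      (-1) ^ δ * ∑ r ∈ Icc 1 (δ + 1), ((δ + 1).choose r : ℂ) *
          algebraMap ℚ ℂ (_root_.bernoulli (δ + 1 - r)) / g ^ r *
          ((aeval (-(g * x)) (Polynomial.bernoulli (r + 1)) - (_root_.bernoulli (r + 1) : ℂ)) /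
            ((r : ℂ) + 1)) := by
    rw [mul_sum]
    refine sum_congr rfl fun r _ => ?_
    rw [eq_ratCast]
    ring
  rw [hs]
  -- For even `δ ≥ 2` the number `B_{δ+1}` is zero, so the parity condition can be traded for a
  -- sign; in this form the term cancels against `r = 0`.
  have h0 : (if Odd δ then (_root_.bernoulli (δ + 1) : ℂ) / (((δ : ℂ) + 1) * (δ : ℂ)) else 0) =
      -((-1) ^ δ * ((_root_.bernoulli (δ + 1) : ℂ) / (((δ : ℂ) + 1) * (δ : ℂ)))) := by
    rcases Nat.even_or_odd δ with h | h
    · rw [if_neg (by simpa using h), _root_.bernoulli_eq_zero_of_odd h.add_one (by omega)]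
      simp
    · rw [if_pos h, h.neg_one_pow]
      ring
  rw [h0]
  simp only [Nat.choose_zero_right, Nat.cast_one, Nat.sub_zero, pow_zero, zero_add, Nat.cast_zero,
    div_one, eq_ratCast, Polynomial.bernoulli_one, _root_.bernoulli_one, map_sub, aeval_X, aeval_C]
  push_cast
  field_simp
  ring

/-- At `x = N` the coefficients are sums of the Stirling coefficients of `log Γ(s - γ j)`. -/
theorem logWCoeff_natCast (g : ℂ) (hg : g ≠ 0) (δ : ℕ) (hδ : 1 ≤ δ) (N : ℕ) :
    logWCoeff g δ N = (-1) ^ δ / ((δ : ℂ) * ((δ : ℂ) + 1)) / g ^ δ *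
      ∑ j ∈ range N, aeval (-(g * j)) (Polynomial.bernoulli (δ + 1)) := by
  induction N with
  | zero =>
    have h0 : ∀ k, aeval (0 : ℂ) (Polynomial.bernoulli k) = (_root_.bernoulli k : ℂ) := fun k => by
      rw [← map_zero (algebraMap ℚ ℂ), aeval_algebraMap_apply]
      simp
    rw [logWCoeff_eq g hg δ hδ]
    simp [h0]
  | succ N ih =>
    rw [sum_range_succ, mul_add, ← ih, logWCoeff_eq g hg δ hδ, logWCoeff_eq g hg δ hδ]
    -- From `N` to `N + 1` the double sum changes by a multiple of `B_{δ+1}(-g(N+1))`, which cancels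
    -- the same value in the first term and leaves `B_{δ+1}(-g N)`.
    have h := sum_bernoulli_mul_aeval_bernoulli_sub (δ + 1) (-(g * ((N + 1 : ℕ) : ℂ))) g hg
    have e : -(g * ((N + 1 : ℕ) : ℂ)) + g = -(g * N) := by push_cast; ring
    rw [e] at h
    have h' : ∑ r ∈ range (δ + 1 + 1), ((δ + 1).choose r : ℂ) *
          algebraMap ℚ ℂ (_root_.bernoulli (δ + 1 - r)) / g ^ r *
          ((aeval (-(g * N)) (Polynomial.bernoulli (r + 1)) - (_root_.bernoulli (r + 1) : ℂ)) /
            ((r : ℂ) + 1)) - ∑ r ∈ range (δ + 1 + 1), ((δ + 1).choose r : ℂ) *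
          algebraMap ℚ ℂ (_root_.bernoulli (δ + 1 - r)) / g ^ r *
          ((aeval (-(g * ((N + 1 : ℕ) : ℂ))) (Polynomial.bernoulli (r + 1)) -
            (_root_.bernoulli (r + 1) : ℂ)) / ((r : ℂ) + 1)) =
          g / g ^ (δ + 1) * aeval (-(g * ((N + 1 : ℕ) : ℂ))) (Polynomial.bernoulli (δ + 1)) := by
      rw [← h, ← sum_sub_distrib]
      refine sum_congr rfl fun r _ => ?_
      ring
    have hgd : g / g ^ (δ + 1) = 1 / g ^ δ := by rw [pow_succ]; field_simp
    rw [hgd] at h'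
    linear_combination ((-1) ^ δ / ((δ : ℂ) * ((δ : ℂ) + 1))) * h'

end Coefficients

/-! ### Stirling series and difference equations at infinity -/

section Asymptotics

open Finset Asymptotics

/-- Convergence at `r / 2` bounds `|c m| (r / 2) ^ m`, so for `x < r / 4` the tail from index `n` is
dominated by a geometric series of ratio `1 / 2`. -/
theorem isBigO_pow_of_hasSum {c : ℕ → ℝ} {f : ℝ → ℝ} {r : ℝ} (hr : 0 < r)
    (hf : ∀ x, 0 < x → x < r → HasSum (fun m => c m * x ^ m) (f x)) (n : ℕ)
    (hc : ∀ m < n, c m = 0) : f =O[𝓝[>] (0 : ℝ)] fun x => x ^ n := by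
  have hs := (hf (r / 2) (by linarith) (by linarith)).summable
  obtain ⟨C, hC⟩ : ∃ C, ∀ m, |c m * (r / 2) ^ m| ≤ C := by
    obtain ⟨C, hC⟩ := hs.tendsto_atTop_zero.abs.bddAbove_range
    exact ⟨C, fun m => hC ⟨m, rfl⟩⟩
  have hC0 : 0 ≤ C := (abs_nonneg _).trans (hC 0)
  refine IsBigO.of_bound (C * (2 / r) ^ n * 2) ?_
  filter_upwards [Ioo_mem_nhdsGT (show (0 : ℝ) < r / 4 by linarith)] with x hx
  have hx0 : 0 < x := hx.1
  have hx1 : x < r / 4 := hx.2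
  have h1 := hf x hx0 (by linarith)
  have h2 : HasSum (fun m => c (m + n) * x ^ (m + n)) (f x) := by
    have := (hasSum_nat_add_iff' (f := fun m => c m * x ^ m) n).2 h1
    rwa [sum_eq_zero (fun i hi => by rw [hc i (mem_range.1 hi), zero_mul]), sub_zero] at this
  have h3 : HasSum (fun m : ℕ => C * (2 / r) ^ n * x ^ n * (1 / 2 : ℝ) ^ m)
      (C * (2 / r) ^ n * x ^ n * 2) := hasSum_geometric_two.mul_left _
  have h4 : ‖f x‖ ≤ C * (2 / r) ^ n * x ^ n * 2 := by
    rw [← h2.tsum_eq]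
    refine tsum_of_norm_bounded h3 fun m => ?_
    have h5 : c (m + n) * x ^ (m + n) = c (m + n) * (r / 2) ^ (m + n) * (2 * x / r) ^ (m + n) := by
      rw [mul_assoc, ← mul_pow]
      congr 2
      field_simp
    rw [h5, norm_mul, Real.norm_eq_abs, Real.norm_eq_abs, abs_of_nonneg (a := (2 * x / r) ^ (m + n)) (by positivity)]
    have h6 : (2 * x / r) ^ (m + n) ≤ (2 / r) ^ n * x ^ n * (1 / 2) ^ m := by
      rw [pow_add, mul_comm, ← mul_pow]
      have : 2 * x / r ≤ 1 / 2 := by rw [div_le_iff₀ hr]; linarith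
      have e : 2 / r * x = 2 * x / r := by ring
      rw [e]
      gcongr
    calc |c (m + n) * (r / 2) ^ (m + n)| * (2 * x / r) ^ (m + n)
        ≤ C * ((2 / r) ^ n * x ^ n * (1 / 2) ^ m) := by
          gcongr
          exact hC _
      _ = _ := by ring
  rw [Real.norm_eq_abs (x ^ n), abs_of_pos (by positivity)]
  linarith [h4]

theorem hasSum_of_forall_eq {f g : ℕ → ℝ} {a : ℝ} (h : ∀ m, f m = g m) (hf : HasSum f a) :
    HasSum g a :=
  funext h ▸ hf

/-- The sum may start at `m = 0` because division by zero makes that coefficient `0`. -/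
theorem hasSum_log_one_add_pow {y : ℝ} (hy : |y| < 1) :
    HasSum (fun m : ℕ => (-1) ^ (m + 1) / (m : ℝ) * y ^ m) (Real.log (1 + y)) := by
  have h := (Real.hasSum_pow_div_log_of_abs_lt_one (x := -y) (by rwa [abs_neg])).neg
  rw [neg_neg, sub_neg_eq_add] at h
  have h2 := (hasSum_nat_add_iff (f := fun m : ℕ => (-1) ^ (m + 1) / (m : ℝ) * y ^ m)
    (g := Real.log (1 + y)) 1).1 (by
    convert h using 2 with m
    push_cast
    rw [neg_pow y]
    ring)
  simpa using h2

/-- With `x = 1 / s` this expands `(s + 1) ^ (-(k+1))`. The binomial coefficient vanishes for `0 < m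
≤ k`; `m = 0` needs its own case because truncated subtraction would give `C(0, 0) = 1` when `k =
0`. -/
theorem hasSum_div_one_add_pow {x : ℝ} (hx : |x| < 1) (k : ℕ) :
    HasSum (fun m : ℕ => (if m = 0 then 0 else (-1) ^ (m + (k + 1)) * ((m - 1).choose k : ℝ)) * x ^ m)
      ((x / (1 + x)) ^ (k + 1)) := by
  have h := (hasSum_choose_mul_geometric_of_norm_lt_one (𝕜 := ℝ) k (r := -x)
    (by simpa using hx)).mul_left (x ^ (k + 1))
  rw [sub_neg_eq_add, mul_one_div, ← div_pow] at h
  have h2 := (hasSum_nat_add_iff (f := fun m : ℕ =>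
    (if m = 0 then 0 else (-1) ^ (m + (k + 1)) * ((m - 1).choose k : ℝ)) * x ^ m)
    (g := (x / (1 + x)) ^ (k + 1)) (k + 1)).1 (by
    refine hasSum_of_forall_eq (fun q => ?_) h
    symm
    rw [if_neg (by omega), neg_pow x]
    have e : q + (k + 1) - 1 = q + k := by omega
    have e2 : (-1 : ℝ) ^ (q + (k + 1) + (k + 1)) = (-1) ^ q := by
      rw [add_assoc, pow_add, ← two_mul, pow_mul]; simp
    rw [e, e2]
    ring)
  rwa [sum_eq_zero, add_zero] at h2
  intro m hm
  split_ifs with h0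
  · simp
  · rw [Nat.choose_eq_zero_of_lt (by have := mem_range.1 hm; omega)]
    simp

/-- The coefficient of `s ^ (-k)` in the asymptotic series of `-log Γ(s + a)`. -/
noncomputable def stirlingCoeff (a : ℝ) (k : ℕ) : ℝ :=
  (-1) ^ k * Polynomial.aeval a (Polynomial.bernoulli (k + 1)) / (k * (k + 1))

/-- The increment in `s` of `log (s ^ (s + a - 1/2) e ^ (-s) / Γ(s + a))`. -/
noncomputable def stirlingIncrement (a s : ℝ) : ℝ :=
  (s + 1 / 2 + a) * Real.log (1 + 1 / s) - 1 - Real.log (1 + a / s)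

/-- This is the comparison of coefficients of `s ^ (-m)` in the difference equation. For `m = p + 1`
it reduces to `∑ C(p+2, k) B_k(a) = (p+2) a ^ (p+1)`, whose terms `k = 0` and `k = 1` are the two
elementary summands on the right. -/
theorem sum_stirlingCoeff_mul_choose (a : ℝ) (m : ℕ) (hm : 1 ≤ m) :
    ∑ k ∈ range (m - 1), stirlingCoeff a (k + 1) * ((-1) ^ (m + (k + 1)) * ((m - 1).choose k : ℝ)) =
      (-1) ^ m * (a ^ m / m - 1 / (m * (m + 1)) - (a - 1 / 2) / m) := by
  obtain ⟨p, rfl⟩ : ∃ p, m = p + 1 := ⟨m - 1, by omega⟩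
  have hb := congrArg (Polynomial.aeval a) (Polynomial.sum_bernoulli (p + 1))
  rw [map_sum, sum_range_succ', sum_range_succ'] at hb
  simp only [Polynomial.aeval_monomial, Algebra.smul_def, map_natCast, zero_add, map_mul,
    Polynomial.bernoulli_zero, Polynomial.bernoulli_one, Nat.choose_zero_right, Nat.choose_one_right,
    map_one, map_sub, Polynomial.aeval_X, Polynomial.aeval_C, Nat.cast_one, mul_one,
    map_add, eq_ratCast] at hb
  push_cast at hb
  have h1 : ∀ k ∈ range p, stirlingCoeff a (k + 1) * ((-1) ^ (p + 1 + (k + 1)) * (p.choose k : ℝ)) =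
      (-1) ^ (p + 1) / ((p + 1) * (p + 2)) * (((p + 1 + 1).choose (k + 1 + 1) : ℝ) *
        Polynomial.aeval a (Polynomial.bernoulli (k + 1 + 1))) := by
    intro k _
    have c1 : ((p + 1 : ℕ) : ℝ) * (p.choose k : ℝ) = ((p + 1).choose (k + 1) : ℝ) * ((k + 1 : ℕ) : ℝ) := by
      exact_mod_cast Nat.add_one_mul_choose_eq p k
    have c2 : ((p + 2 : ℕ) : ℝ) * ((p + 1).choose (k + 1) : ℝ) =
        ((p + 1 + 1).choose (k + 1 + 1) : ℝ) * ((k + 2 : ℕ) : ℝ) := by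
      exact_mod_cast Nat.add_one_mul_choose_eq (p + 1) (k + 1)
    push_cast at c1 c2
    have hs : (-1 : ℝ) ^ (k + 1) * (-1) ^ (p + 1 + (k + 1)) = (-1) ^ (p + 1) := by
      rw [← pow_add, show k + 1 + (p + 1 + (k + 1)) = p + 1 + 2 * (k + 1) by ring, pow_add, pow_mul]
      simp
    unfold stirlingCoeff
    push_cast
    have hk1 : (k : ℝ) + 1 ≠ 0 := by positivity
    have hk2 : (k : ℝ) + 1 + 1 ≠ 0 := by positivity
    have hp1 : (p : ℝ) + 1 ≠ 0 := by positivity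
    have hp2 : (p : ℝ) + 2 ≠ 0 := by positivity
    have c3 : ((p : ℝ) + 1) * (p + 2) * (p.choose k : ℝ) =
        ((p + 1 + 1).choose (k + 1 + 1) : ℝ) * ((k + 1) * (k + 1 + 1)) := by
      linear_combination ((p : ℝ) + 2) * c1 + ((k : ℝ) + 1) * c2
    rw [← hs, div_mul_eq_mul_div, div_mul_eq_mul_div, div_eq_div_iff (by positivity) (by positivity)]
    linear_combination ((-1 : ℝ) ^ (k + 1) * (-1) ^ (p + 1 + (k + 1)) *
      Polynomial.aeval a (Polynomial.bernoulli (k + 1 + 1))) * c3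
  rw [Nat.add_sub_cancel, sum_congr rfl h1, ← mul_sum]
  have h2 : ∑ k ∈ range p, (((p + 1 + 1).choose (k + 1 + 1) : ℝ) *
        Polynomial.aeval a (Polynomial.bernoulli (k + 1 + 1))) =
      (p + 1 + 1) * a ^ (p + 1) - 1 - (p + 1 + 1) * (a - 1 / 2) := by
    linear_combination hb
  rw [h2]
  push_cast
  have hp1 : (p : ℝ) + 1 ≠ 0 := by positivity
  have hp2 : (p : ℝ) + 2 ≠ 0 := by positivity
  have hp3 : (p : ℝ) + 1 + 1 ≠ 0 := by positivity
  field_simp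
  ring
theorem hasSum_stirlingIncrement (a : ℝ) {x : ℝ} (hx0 : 0 < x) (hx1 : x < 1) (hax : |a * x| < 1) :
    HasSum (fun m : ℕ => ((-1) ^ m / ((m : ℝ) + 1) - (1 / 2 + a) * ((-1) ^ m / (m : ℝ)) -
      (if m = 0 then 1 else 0) + (-1) ^ m * a ^ m / (m : ℝ)) * x ^ m) (stirlingIncrement a x⁻¹) := by
  have hl := hasSum_log_one_add_pow (y := x) (by rwa [abs_of_pos hx0])
  have hla := hasSum_log_one_add_pow hax
  have h1 : HasSum (fun m : ℕ => (-1) ^ m / ((m : ℝ) + 1) * x ^ m) (Real.log (1 + x) / x) := by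
    have := (hasSum_nat_add_iff' (f := fun m : ℕ => (-1) ^ (m + 1) / (m : ℝ) * x ^ m) 1).2 hl
    simp only [range_one, sum_singleton, Nat.cast_zero, div_zero, zero_mul, sub_zero] at this
    refine hasSum_of_forall_eq (fun m => ?_) (this.div_const x)
    push_cast
    field_simp
    ring
  have h2 : HasSum (fun m : ℕ => (if m = 0 then (1 : ℝ) else 0) * x ^ m) 1 := by
    have := hasSum_ite_eq (0 : ℕ) (1 : ℝ)
    refine hasSum_of_forall_eq (fun m => ?_) this
    split_ifs with h <;> simp [h]
  have h := ((h1.add (hl.mul_left (1 / 2 + a))).sub h2).sub hla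
  have e : Real.log (1 + x) / x + (1 / 2 + a) * Real.log (1 + x) - 1 - Real.log (1 + a * x) =
      stirlingIncrement a x⁻¹ := by
    unfold stirlingIncrement
    rw [one_div x⁻¹, inv_inv, div_inv_eq_mul]
    ring
  rw [e] at h
  refine hasSum_of_forall_eq (fun m => ?_) h
  rw [mul_pow]
  ring

theorem stirlingCoeff_zero (a : ℝ) : stirlingCoeff a 0 = 0 := by simp [stirlingCoeff]

/-- The truncated Stirling series solves the difference equation up to the expected order. -/
theorem isBigO_stirling_sub (a : ℝ) (n : ℕ) :
    (fun s : ℝ => ∑ k ∈ range n, stirlingCoeff a k * ((s + 1)⁻¹ ^ k - s⁻¹ ^ k) -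
      stirlingIncrement a s) =O[atTop] fun s => s⁻¹ ^ (n + 1) := by
  -- On `0 < x < r` both `log (1 + x)` and `log (1 + a x)` have convergent power series.
  obtain ⟨r, hr0, hr1, hra⟩ : ∃ r : ℝ, 0 < r ∧ r ≤ 1 ∧ r * |a| ≤ 1 := by
    refine ⟨(1 + |a|)⁻¹, by positivity, inv_le_one_of_one_le₀ (by linarith [abs_nonneg a]), ?_⟩
    rw [inv_mul_le_iff₀ (by positivity)]
    linarith
  have key : (fun x : ℝ => ∑ k ∈ range n, stirlingCoeff a k * ((x / (1 + x)) ^ k - x ^ k) -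
      stirlingIncrement a x⁻¹) =O[𝓝[>] (0 : ℝ)] fun x => x ^ (n + 1) := by
    refine isBigO_pow_of_hasSum (r := r) (c := fun m => ∑ k ∈ range n, stirlingCoeff a k *
      ((if m = 0 then 0 else (-1) ^ (m + k) * ((m - 1).choose (k - 1) : ℝ)) -
        (if m = k then 1 else 0)) - ((-1) ^ m / ((m : ℝ) + 1) - (1 / 2 + a) * ((-1) ^ m / (m : ℝ)) -
      (if m = 0 then 1 else 0) + (-1) ^ m * a ^ m / (m : ℝ))) hr0 ?_ _ ?_
    · intro x hx0 hxr
      have hx1 : x < 1 := by linarith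
      have hax : |a * x| < 1 := by
        rw [abs_mul, abs_of_pos hx0, mul_comm]
        rcases (abs_nonneg a).eq_or_lt with h | h
        · rw [← h]; simp
        · exact (mul_lt_mul_of_pos_right hxr h).trans_le hra
      have hsum : HasSum (fun m : ℕ => ∑ k ∈ range n, stirlingCoeff a k *
          ((if m = 0 then 0 else (-1) ^ (m + k) * ((m - 1).choose (k - 1) : ℝ)) -
            (if m = k then 1 else 0)) * x ^ m)
          (∑ k ∈ range n, stirlingCoeff a k * ((x / (1 + x)) ^ k - x ^ k)) := by
        refine hasSum_sum fun k _ => ?_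
        rcases Nat.eq_zero_or_pos k with rfl | hk
        · simp only [stirlingCoeff_zero, zero_mul]
          exact hasSum_zero
        · obtain ⟨q, rfl⟩ : ∃ q, k = q + 1 := ⟨k - 1, by omega⟩
          have h1 := hasSum_div_one_add_pow (x := x) (by rwa [abs_of_pos hx0]) q
          have h2 : HasSum (fun m : ℕ => (if m = q + 1 then (1 : ℝ) else 0) * x ^ m) (x ^ (q + 1)) := by
            have := hasSum_ite_eq (q + 1 : ℕ) (x ^ (q + 1))
            refine hasSum_of_forall_eq (fun m => ?_) this
            split_ifs with h <;> simp [h]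
          refine hasSum_of_forall_eq (fun m => ?_) ((h1.sub h2).mul_left (stirlingCoeff a (q + 1)))
          rw [Nat.add_sub_cancel]
          ring
      refine hasSum_of_forall_eq (fun m => ?_) (hsum.sub (hasSum_stirlingIncrement a hx0 hx1 hax))
      rw [← sum_mul]
      ring
    · intro m hm
      rcases Nat.eq_zero_or_pos m with rfl | hm0
      · rw [sum_eq_zero]
        · simp
        · intro k _
          rcases Nat.eq_zero_or_pos k with rfl | hk
          · simp [stirlingCoeff_zero]
          · rw [if_pos rfl, if_neg (by omega)]; simp
      · have hs : ∑ k ∈ range n, stirlingCoeff a k *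
            ((if m = 0 then 0 else (-1) ^ (m + k) * ((m - 1).choose (k - 1) : ℝ)) -
              (if m = k then 1 else 0)) = ∑ k ∈ range m, stirlingCoeff a k *
                ((-1) ^ (m + k) * ((m - 1).choose (k - 1) : ℝ)) := by
          have h1 : ∑ k ∈ range m, stirlingCoeff a k *
                ((-1) ^ (m + k) * ((m - 1).choose (k - 1) : ℝ)) = ∑ k ∈ range m, stirlingCoeff a k *
            ((if m = 0 then 0 else (-1) ^ (m + k) * ((m - 1).choose (k - 1) : ℝ)) -
              (if m = k then 1 else 0)) := by
            refine sum_congr rfl fun k hk => ?_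
            have := mem_range.1 hk
            rw [if_neg (by omega), if_neg (by omega), sub_zero]
          rw [h1]
          -- Indices `k ≥ m` contribute nothing: for `k = m` the two powers of `x` cancel, and for
          -- `k > m` neither reaches order `m`. Hence the coefficient does not depend on the
          -- truncation `n ≥ m`.
          refine (sum_subset (range_subset_range.2 (by omega)) fun k hk hk' => ?_).symm
          have hk2 : m ≤ k := by simpa using hk'
          rw [if_neg (by omega)]
          rcases hk2.eq_or_lt with rfl | hlt
          · rw [if_pos rfl, Nat.choose_self, ← two_mul, pow_mul]
            simp
          · rw [if_neg (by omega), Nat.choose_eq_zero_of_lt (by omega)]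
            simp
        rw [hs, if_neg (by omega)]
        obtain ⟨p, rfl⟩ : ∃ p, m = p + 1 := ⟨m - 1, by omega⟩
        rw [sum_range_succ', stirlingCoeff_zero, zero_mul, add_zero]
        have h3 := sum_stirlingCoeff_mul_choose a (p + 1) (by omega)
        simp only [Nat.add_sub_cancel] at h3 ⊢
        rw [h3]
        push_cast
        have hp1 : (p : ℝ) + 1 ≠ 0 := by positivity
        have hp2 : (p : ℝ) + 1 + 1 ≠ 0 := by positivity
        field_simp
        ring
  have h := key.comp_tendsto tendsto_inv_atTop_nhdsGT_zero
  refine h.congr' ?_ EventuallyEq.rfl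
  filter_upwards [eventually_gt_atTop 0] with s hs
  have e : s⁻¹ / (1 + s⁻¹) = (s + 1)⁻¹ := by field_simp
  simp only [Function.comp_apply, inv_inv, e]

/-- A telescoping argument: for `y ≥ 1` one has `y ^ (-n-1) ≤ 2 (y ^ (-n) - (y+1) ^ (-n))`, so `‖D
(s + k)‖ - 2 C (s + k) ^ (-n)` increases in `k`. Its limit is `0`, so it is nonpositive at `k = 0`.
-/
theorem isBigO_inv_pow_of_tendsto_zero {D : ℝ → ℂ} (hD : Tendsto D atTop (𝓝 0)) {n : ℕ} (hn : 1 ≤ n)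
    (h : (fun s => D (s + 1) - D s) =O[atTop] fun s : ℝ => s⁻¹ ^ (n + 1)) :
    D =O[atTop] fun s : ℝ => s⁻¹ ^ n := by
  obtain ⟨C, hC0, hC⟩ := h.exists_pos
  rw [IsBigOWith] at hC
  obtain ⟨S, hS⟩ := eventually_atTop.1 (hC.and (eventually_ge_atTop 1))
  refine IsBigO.of_bound (2 * C) (eventually_atTop.2 ⟨S, fun s hs => ?_⟩)
  have hs1 : ∀ k : ℕ, 1 ≤ s + k := fun k => by
    have := (hS s hs).2
    have : (0 : ℝ) ≤ k := Nat.cast_nonneg k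
    linarith
  have step : ∀ y : ℝ, 1 ≤ y → y⁻¹ ^ (n + 1) ≤ 2 * (y⁻¹ ^ n - (y + 1)⁻¹ ^ n) := by
    intro y hy
    have hy0 : 0 < y := by linarith
    obtain ⟨q, rfl⟩ : ∃ q, n = q + 1 := ⟨n - 1, by omega⟩
    have h1 : (y + 1)⁻¹ ^ (q + 1) ≤ y⁻¹ ^ q * (y + 1)⁻¹ := by
      rw [pow_succ]
      have : (y + 1)⁻¹ ≤ y⁻¹ := inv_anti₀ hy0 (by linarith)
      gcongr
    have h2 : y⁻¹ ^ 2 ≤ 2 * (y⁻¹ - (y + 1)⁻¹) := by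
      have : 2 * (y⁻¹ - (y + 1)⁻¹) - y⁻¹ ^ 2 = (y - 1) / (y ^ 2 * (y + 1)) := by
        field_simp
        ring
      have h3 : 0 ≤ (y - 1) / (y ^ 2 * (y + 1)) := div_nonneg (by linarith) (by positivity)
      linarith
    calc y⁻¹ ^ (q + 1 + 1) = y⁻¹ ^ q * y⁻¹ ^ 2 := by ring
      _ ≤ y⁻¹ ^ q * (2 * (y⁻¹ - (y + 1)⁻¹)) := by gcongr
      _ = 2 * (y⁻¹ ^ (q + 1) - y⁻¹ ^ q * (y + 1)⁻¹) := by ring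
      _ ≤ _ := by linarith
  have hmono : Monotone fun k : ℕ => ‖D (s + k)‖ - 2 * C * (s + k)⁻¹ ^ n := by
    refine monotone_nat_of_le_succ fun k => ?_
    have hk := hs1 k
    have h1 := (hS (s + k) (by have : (0 : ℝ) ≤ k := Nat.cast_nonneg k; linarith)).1
    rw [Real.norm_of_nonneg (by positivity)] at h1
    have h2 := step _ hk
    have h3 : ‖D (s + k)‖ ≤ ‖D (s + k + 1)‖ + ‖D (s + k + 1) - D (s + k)‖ := by
      exact norm_le_norm_add_norm_sub _ _
    push_cast
    rw [← add_assoc]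
    have h4 := mul_le_mul_of_nonneg_left h2 hC0.le
    linarith
  have ht : Tendsto (fun k : ℕ => s + (k : ℝ)) atTop atTop :=
    tendsto_atTop_add_const_left _ _ tendsto_natCast_atTop_atTop
  have hlim : Tendsto (fun k : ℕ => ‖D (s + k)‖ - 2 * C * (s + k)⁻¹ ^ n) atTop (𝓝 0) := by
    have h1 := (hD.comp ht).norm
    have h2 : Tendsto (fun k : ℕ => (s + (k : ℝ))⁻¹ ^ n) atTop (𝓝 0) := by
      have := (tendsto_inv_atTop_zero.comp ht).pow n
      rwa [zero_pow (by omega)] at this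
    have := h1.sub (h2.const_mul (2 * C))
    simpa using this
  have h0 := hmono.ge_of_tendsto hlim 0
  have hspos : 0 < s := by have := hs1 0; simp at this; linarith
  rw [Real.norm_of_nonneg (by positivity : (0 : ℝ) ≤ s⁻¹ ^ n)]
  simpa using h0

/-- A function vanishing at infinity whose increments are sums of Stirling increments is asymptotic
to the corresponding sum of Stirling series. -/
theorem isBigO_sub_sum_stirlingCoeff {f : ℝ → ℂ} (hf : Tendsto f atTop (𝓝 0)) {ι : Type*}
    (J : Finset ι) (a : ι → ℝ)
    (h : ∀ᶠ s in atTop, f (s + 1) = f s + ((∑ j ∈ J, stirlingIncrement (a j) s : ℝ) : ℂ)) (n : ℕ) :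
    (fun s => f s - ((∑ k ∈ range n, (∑ j ∈ J, stirlingCoeff (a j) k) * s⁻¹ ^ k : ℝ) : ℂ))
      =O[atTop] fun s : ℝ => s⁻¹ ^ n := by
  rcases Nat.eq_zero_or_pos n with rfl | hn
  · simpa using hf.isBigO_one ℝ
  have hP : ∀ s : ℝ, ∑ k ∈ range n, (∑ j ∈ J, stirlingCoeff (a j) k) * s⁻¹ ^ k =
      ∑ j ∈ J, ∑ k ∈ range n, stirlingCoeff (a j) k * s⁻¹ ^ k := by
    intro s
    rw [sum_comm]
    exact sum_congr rfl fun k _ => by rw [sum_mul]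
  refine isBigO_inv_pow_of_tendsto_zero ?_ hn ?_
  · have h1 : Tendsto (fun s : ℝ => ∑ k ∈ range n, (∑ j ∈ J, stirlingCoeff (a j) k) * s⁻¹ ^ k)
        atTop (𝓝 0) := by
      rw [← sum_const_zero (s := range n)]
      refine tendsto_finsetSum _ fun k _ => ?_
      rcases Nat.eq_zero_or_pos k with rfl | hk
      · simp [stirlingCoeff_zero]
      · have := ((tendsto_inv_atTop_zero (𝕜 := ℝ)).pow k).const_mul (∑ j ∈ J, stirlingCoeff (a j) k)
        rwa [zero_pow (by omega), mul_zero] at this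
    have h2 := (Complex.continuous_ofReal.tendsto 0).comp h1
    have := hf.sub h2
    simpa using this
  · have hb : (fun s : ℝ => ∑ j ∈ J, (∑ k ∈ range n, stirlingCoeff (a j) k *
        ((s + 1)⁻¹ ^ k - s⁻¹ ^ k) - stirlingIncrement (a j) s)) =O[atTop] fun s => s⁻¹ ^ (n + 1) := by
      simpa only [Finset.sum_fn] using
        IsBigO.sum fun j (_ : j ∈ J) => isBigO_stirling_sub (a j) n
    have hb2 : (fun s : ℝ => (-((∑ j ∈ J, (∑ k ∈ range n, stirlingCoeff (a j) k *
        ((s + 1)⁻¹ ^ k - s⁻¹ ^ k) - stirlingIncrement (a j) s) : ℝ) : ℂ))) =O[atTop]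
          fun s : ℝ => s⁻¹ ^ (n + 1) :=
      (IsBigO.of_bound 1 (Eventually.of_forall fun s => by simp only [norm_neg, Complex.norm_real, one_mul]; exact le_rfl)).trans hb
    refine hb2.congr' ?_ EventuallyEq.rfl
    filter_upwards [h] with s hs
    rw [hs, hP, hP]
    simp only [mul_sub, sum_sub_distrib]
    push_cast
    ring

end Asymptotics

/-! ### The regularized ensemble: bounds, integrability, symmetry -/

section Aomoto

open Finset

variable {N : ℕ}

/-- A regularization of `|vand u| ^ (2 * γ)`, smooth for `ε > 0`. -/
noncomputable def regVand (γ ε : ℝ) (u : Fin N → ℝ) : ℝ :=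
  ∏ i, ∏ j, if i = j then 1 else ((u i - u j) ^ 2 + ε) ^ (γ / 2)

/-- The one-variable weight `e ^ (-i p x) (1 - i x) ^ (-s)`. -/
noncomputable def weight (p s x : ℝ) : ℂ :=
  Complex.exp (-(Complex.I * p * x) - s * Complex.log (1 - Complex.I * x))

/-- The integrand with test function `q`. -/
noncomputable def ensemble (γ ε p s : ℝ) (q : (Fin N → ℝ) → ℂ) (u : Fin N → ℝ) : ℂ :=
  (regVand γ ε u : ℂ) * (q u * ∏ j, weight p s (u j))

theorem one_sub_I_mul_mem_slitPlane (x : ℝ) : 1 - Complex.I * x ∈ Complex.slitPlane := by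
  left
  simp

theorem norm_one_sub_I_mul (x : ℝ) : ‖1 - Complex.I * (x : ℂ)‖ = (1 + x ^ 2) ^ (1 / 2 : ℝ) := by
  rw [← Real.sqrt_eq_rpow, Complex.norm_def, Complex.normSq_apply]
  congr 1
  simp
  ring

theorem norm_weight (p s x : ℝ) : ‖weight p s x‖ = (1 + x ^ 2) ^ (-s / 2) := by
  have h : 0 < 1 + x ^ 2 := by positivity
  rw [weight, Complex.norm_exp, Complex.sub_re, Complex.re_ofReal_mul, Complex.log_re,
    norm_one_sub_I_mul, Real.log_rpow h, Real.rpow_def_of_pos h]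
  congr 1
  simp
  ring

theorem continuous_weight (p s : ℝ) : Continuous (weight p s) := by
  unfold weight
  have : Continuous fun x : ℝ => Complex.log (1 - Complex.I * x) :=
    Continuous.clog (by fun_prop) one_sub_I_mul_mem_slitPlane
  fun_prop

theorem regVand_nonneg {γ ε : ℝ} (hε : 0 ≤ ε) (u : Fin N → ℝ) : 0 ≤ regVand γ ε u :=
  prod_nonneg fun i _ => prod_nonneg fun j _ => by split_ifs <;> positivity

theorem continuous_regVand {γ : ℝ} (hγ : 0 < γ) (ε : ℝ) :
    Continuous (regVand γ ε : (Fin N → ℝ) → ℝ) := by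
  unfold regVand
  refine continuous_finsetProd _ fun i _ => continuous_finsetProd _ fun j _ => ?_
  split_ifs
  · fun_prop
  · exact Continuous.rpow_const (by fun_prop) fun _ => Or.inr (by positivity)

/-- Each off-diagonal factor satisfies `(x - y)² + ε ≤ 4 (1 + x²)(1 + y²)`. Enlarging the diagonal
factors as well makes the bound a full square array, in which each variable collects the exponent
`2N · γ/2`. -/
theorem regVand_le {γ ε : ℝ} (hγ : 0 < γ) (hε0 : 0 ≤ ε) (hε1 : ε ≤ 1) (u : Fin N → ℝ) :
    regVand γ ε u ≤ ∏ i, (2 * (1 + u i ^ 2)) ^ (γ * N) := by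
  have hb : ∀ i, 0 < 2 * (1 + u i ^ 2) := fun i => by positivity
  have hb1 : ∀ i, 1 ≤ 2 * (1 + u i ^ 2) := fun i => by nlinarith [sq_nonneg (u i)]
  have h1 : regVand γ ε u ≤
      ∏ i, ∏ j, ((2 * (1 + u i ^ 2)) ^ (γ / 2) * (2 * (1 + u j ^ 2)) ^ (γ / 2)) := by
    refine prod_le_prod (fun i _ => prod_nonneg fun j _ => by split_ifs <;> positivity) fun i _ =>
      prod_le_prod (fun j _ => by split_ifs <;> positivity) fun j _ => ?_
    split_ifs
    · exact one_le_mul_of_one_le_of_one_le (Real.one_le_rpow (hb1 i) (by positivity))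
        (Real.one_le_rpow (hb1 j) (by positivity))
    · rw [← Real.mul_rpow (hb i).le (hb j).le]
      refine Real.rpow_le_rpow (by positivity) ?_ (by positivity)
      nlinarith [sq_nonneg (u i + u j), mul_nonneg (sq_nonneg (u i)) (sq_nonneg (u j)),
        sq_nonneg (u i), sq_nonneg (u j)]
  refine h1.trans (le_of_eq ?_)
  simp only [prod_mul_distrib, prod_const, card_univ, Fintype.card_fin]
  rw [prod_pow, ← mul_pow, ← sq, ← pow_mul, ← prod_pow]
  refine prod_congr rfl fun i _ => ?_
  rw [← Real.rpow_natCast, ← Real.rpow_mul (hb i).le]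
  congr 1
  push_cast
  ring

theorem integrable_prod_inv_one_add_sq :
    Integrable fun u : Fin N → ℝ => ∏ i, (1 + u i ^ 2)⁻¹ :=
  Integrable.fintype_prod (f := fun _ : Fin N => fun x : ℝ => (1 + x ^ 2)⁻¹)
    fun _ => integrable_inv_one_add_sq

/-- The threshold on `s` makes the total exponent `γ N + 1 - s / 2` of `1 + u_i²` at most `-1`. The
bound is independent of `ε`, `p` and `s`, so it also serves as the dominating function when `ε → 0`
and when differentiating in `p`. -/
theorem norm_ensemble_le {γ ε p s K : ℝ} (hγ : 0 < γ) (hε0 : 0 ≤ ε) (hε1 : ε ≤ 1)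
    (hs : 2 * γ * N + 4 ≤ s) {q : (Fin N → ℝ) → ℂ} {u : Fin N → ℝ}
    (hq : ‖q u‖ ≤ K * ∏ i, (1 + u i ^ 2)) :
    ‖ensemble γ ε p s q u‖ ≤ K * ((2 : ℝ) ^ (γ * N)) ^ N * ∏ i, (1 + u i ^ 2)⁻¹ := by
  have hP : 0 < ∏ i, (1 + u i ^ 2) := prod_pos fun i _ => by positivity
  have hK : 0 ≤ K := nonneg_of_mul_nonneg_left ((norm_nonneg _).trans hq) hP
  rw [ensemble, norm_mul, norm_mul, norm_prod, Complex.norm_real,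
    Real.norm_of_nonneg (regVand_nonneg hε0 u)]
  have h2 : ∏ i, ‖weight p s (u i)‖ = ∏ i, (1 + u i ^ 2) ^ (-s / 2) :=
    prod_congr rfl fun i _ => norm_weight p s (u i)
  rw [h2]
  have h3 : 0 ≤ ∏ i, (1 + u i ^ 2) ^ (-s / 2) := prod_nonneg fun i _ => by positivity
  have h4 : 0 ≤ ∏ i, (2 * (1 + u i ^ 2)) ^ (γ * N) := prod_nonneg fun i _ => by positivity
  calc regVand γ ε u * (‖q u‖ * ∏ i, (1 + u i ^ 2) ^ (-s / 2))
      ≤ (∏ i, (2 * (1 + u i ^ 2)) ^ (γ * N)) *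
        ((K * ∏ i, (1 + u i ^ 2)) * ∏ i, (1 + u i ^ 2) ^ (-s / 2)) := by
        gcongr
        exact regVand_le hγ hε0 hε1 u
    _ = K * ∏ i, ((2 * (1 + u i ^ 2)) ^ (γ * N) * (1 + u i ^ 2) * (1 + u i ^ 2) ^ (-s / 2)) := by
        simp only [prod_mul_distrib]
        ring
    _ ≤ K * ∏ i, ((2 : ℝ) ^ (γ * N) * (1 + u i ^ 2)⁻¹) := by
        refine mul_le_mul_of_nonneg_left (prod_le_prod (fun i _ => by positivity) fun i _ => ?_) hK
        have hy : 1 ≤ 1 + u i ^ 2 := by nlinarith [sq_nonneg (u i)]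
        have hy0 : 0 < 1 + u i ^ 2 := by positivity
        rw [Real.mul_rpow (by norm_num) hy0.le, mul_assoc, mul_assoc]
        refine mul_le_mul_of_nonneg_left ?_ (by positivity)
        rw [← mul_assoc, ← Real.rpow_add_one hy0.ne', ← Real.rpow_add hy0, ← Real.rpow_neg_one]
        exact Real.rpow_le_rpow_of_exponent_le hy (by linarith)
    _ = _ := by
        rw [prod_mul_distrib, prod_const, card_univ, Fintype.card_fin]
        ring

theorem continuous_ensemble {γ : ℝ} (hγ : 0 < γ) (ε p s : ℝ) {q : (Fin N → ℝ) → ℂ}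
    (hq : Continuous q) : Continuous (ensemble γ ε p s q) := by
  unfold ensemble
  have h1 : Continuous fun u : Fin N → ℝ => ∏ j, weight p s (u j) :=
    continuous_finsetProd _ fun j _ => (continuous_weight p s).comp (continuous_apply j)
  exact (Complex.continuous_ofReal.comp (continuous_regVand hγ ε)).mul (hq.mul h1)

theorem integrable_ensemble {γ ε p s K : ℝ} (hγ : 0 < γ) (hε0 : 0 ≤ ε) (hε1 : ε ≤ 1)
    (hs : 2 * γ * N + 4 ≤ s) {q : (Fin N → ℝ) → ℂ} (hqc : Continuous q)
    (hq : ∀ u, ‖q u‖ ≤ K * ∏ i, (1 + u i ^ 2)) : Integrable (ensemble γ ε p s q) :=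
  (integrable_prod_inv_one_add_sq.const_mul (K * ((2 : ℝ) ^ (γ * N)) ^ N)).mono'
    (continuous_ensemble hγ ε p s hqc).aestronglyMeasurable
    (Eventually.of_forall fun u => norm_ensemble_le hγ hε0 hε1 hs (hq u))

theorem regVand_comp_perm (γ ε : ℝ) (σ : Equiv.Perm (Fin N)) (u : Fin N → ℝ) :
    regVand γ ε (u ∘ σ) = regVand γ ε u := by
  unfold regVand
  rw [← Equiv.prod_comp σ fun i => ∏ j, if i = j then 1 else ((u i - u j) ^ 2 + ε) ^ (γ / 2)]
  refine prod_congr rfl fun i _ => ?_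
  rw [← Equiv.prod_comp σ fun j => if σ i = j then 1 else ((u (σ i) - u j) ^ 2 + ε) ^ (γ / 2)]
  simp

theorem integral_ensemble_comp_swap (γ ε p s : ℝ) (q : (Fin N → ℝ) → ℂ) (a b : Fin N) :
    ∫ u, ensemble γ ε p s (fun u => q (u ∘ Equiv.swap a b)) u = ∫ u, ensemble γ ε p s q u := by
  have h := (volume_measurePreserving_piCongrLeft (fun _ : Fin N => ℝ)
    (Equiv.swap a b)).integral_comp' (g := ensemble γ ε p s q)
  rw [← h]
  refine integral_congr_ae (Eventually.of_forall fun u => ?_)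
  have e : MeasurableEquiv.piCongrLeft (fun _ : Fin N => ℝ) (Equiv.swap a b) u =
      u ∘ Equiv.swap a b := by
    ext j
    have := MeasurableEquiv.piCongrLeft_apply_apply (β := fun _ : Fin N => ℝ) (Equiv.swap a b) u
      (Equiv.swap a b j)
    simpa using this
  simp only [e, ensemble, regVand_comp_perm]
  congr 2
  exact (Equiv.prod_comp (Equiv.swap a b) fun j => weight p s (u j)).symm

theorem integral_eq_zero_of_hasLineDerivAt {f f' : (Fin N → ℝ) → ℂ} {v : Fin N → ℝ}
    (hf : Integrable f) (hf' : Integrable f') (h : ∀ u, HasLineDerivAt ℝ f (f' u) u v) :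
    ∫ u, f' u = 0 := by
  have := integral_bilinear_hasLineDerivAt_right_eq_neg_left_of_integrable
    (μ := (volume : Measure (Fin N → ℝ))) (f := f) (f' := f') (g := fun _ => (1 : ℂ))
    (g' := fun _ => 0) (v := v) (B := ContinuousLinearMap.mul ℝ ℂ)
    (by simpa using hf') (by simp) (by simpa using hf) (fun u _ => h u)
    (fun u _ => by simpa [HasLineDerivAt] using hasDerivAt_const (0 : ℝ) (1 : ℂ))
  simpa using this

end Aomoto

/-! ### Derivatives of the regularized integrand -/

section Recursion

open Finset

variable {N : ℕ}

/-- The monomial `∏_{j ∈ S} (1 - i u_j)`. -/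
noncomputable def linProd (S : Finset (Fin N)) (u : Fin N → ℝ) : ℂ :=
  ∏ j ∈ S, (1 - Complex.I * u j)

/-- The regularization of `1 / (u_a - u_j)`. -/
noncomputable def regInv (ε : ℝ) (a j : Fin N) (u : Fin N → ℝ) : ℝ :=
  (u a - u j) / ((u a - u j) ^ 2 + ε)

theorem regVand_eq_exp {γ ε : ℝ} (hε : 0 < ε) (u : Fin N → ℝ) :
    regVand γ ε u =
      Real.exp (∑ i, ∑ j, if i = j then 0 else γ / 2 * Real.log ((u i - u j) ^ 2 + ε)) := by
  simp only [Real.exp_sum, regVand]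
  refine prod_congr rfl fun i _ => prod_congr rfl fun j _ => ?_
  split_ifs
  · simp
  · rw [Real.rpow_def_of_pos (by positivity), mul_comm]

/-- Writing the product as an exponential turns this into a logarithmic derivative. Every pair
containing `a` occurs in both orders, and antisymmetry of `regInv` makes the two contributions
equal, whence the factor `2 γ`. -/
theorem hasLineDerivAt_regVand {γ ε : ℝ} (hε : 0 < ε) (a : Fin N) (u : Fin N → ℝ) :
    HasLineDerivAt ℝ (regVand γ ε) (regVand γ ε u * (2 * γ * ∑ j, regInv ε a j u)) u
      (Pi.single a 1) := by
  set d : Fin N → ℝ := Pi.single a 1 with hd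
  have h1 : ∀ i j, HasDerivAt (fun t : ℝ => if i = j then 0 else
      γ / 2 * Real.log (((u + t • d) i - (u + t • d) j) ^ 2 + ε))
      (γ * regInv ε i j u * (d i - d j)) 0 := by
    intro i j
    split_ifs with h
    · simpa [h] using hasDerivAt_const (0 : ℝ) (0 : ℝ)
    · have h2 : HasDerivAt (fun t : ℝ => ((u + t • d) i - (u + t • d) j) ^ 2 + ε)
          (2 * (u i - u j) * (d i - d j)) 0 := by
        have h3 : HasDerivAt (fun t : ℝ => (u i - u j) + t * (d i - d j)) (d i - d j) 0 := by
          simpa using ((hasDerivAt_id (0 : ℝ)).mul_const (d i - d j)).const_add (u i - u j)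
        have h4 := (h3.fun_pow 2).add_const ε
        refine (h4.congr_deriv (by simp)).congr_of_eventuallyEq (Eventually.of_forall fun t => ?_)
        simp only [Pi.add_apply, Pi.smul_apply, smul_eq_mul]
        ring
      have hne : ((u + (0 : ℝ) • d) i - (u + (0 : ℝ) • d) j) ^ 2 + ε ≠ 0 := by positivity
      refine ((h2.log hne).const_mul (γ / 2)).congr_deriv ?_
      simp only [zero_smul, add_zero, regInv]
      ring
  have h5 := (HasDerivAt.fun_sum (u := univ) fun i _ => HasDerivAt.fun_sum (u := univ) fun j _ =>
    h1 i j).exp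
  have e : (fun t : ℝ => regVand γ ε (u + t • d)) = fun t : ℝ => Real.exp (∑ i, ∑ j, if i = j then 0
      else γ / 2 * Real.log (((u + t • d) i - (u + t • d) j) ^ 2 + ε)) :=
    funext fun t => regVand_eq_exp hε _
  rw [HasLineDerivAt, e]
  refine h5.congr_deriv ?_
  have e0 := regVand_eq_exp (γ := γ) hε (u + (0 : ℝ) • d)
  rw [← e0, zero_smul, add_zero]
  congr 1
  have hanti : ∀ i j, regInv ε i j u = -regInv ε j i u := by
    intro i j
    simp only [regInv]
    rw [← neg_sub (u j) (u i), neg_sq]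
    ring
  have hsingle : ∀ g : Fin N → ℝ, ∑ i, g i * d i = g a := by
    intro g
    rw [sum_eq_single a]
    · simp [hd]
    · intro b _ hb
      simp [hd, hb]
    · simp
  have s1 : ∑ i, ∑ j, γ * regInv ε i j u * d i = γ * ∑ j, regInv ε a j u := by
    rw [mul_sum, ← hsingle fun i => ∑ j, γ * regInv ε i j u]
    exact sum_congr rfl fun i _ => by rw [sum_mul]
  have s2 : ∑ i, ∑ j, γ * regInv ε i j u * d j = -(γ * ∑ j, regInv ε a j u) := by
    rw [sum_comm, mul_sum, ← sum_neg_distrib, ← hsingle fun j => ∑ i, -(γ * regInv ε j i u)]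
    refine sum_congr rfl fun j _ => ?_
    rw [sum_mul]
    refine sum_congr rfl fun i _ => ?_
    rw [hanti i j]
    ring
  simp only [mul_sub, sum_sub_distrib]
  rw [s1, s2]
  ring

theorem hasLineDerivAt_prod_weight (p s : ℝ) (a : Fin N) (u : Fin N → ℝ) :
    HasLineDerivAt ℝ (fun u : Fin N → ℝ => ∏ j, weight p s (u j))
      ((∏ j, weight p s (u j)) * (-(Complex.I * p) + s * Complex.I / (1 - Complex.I * u a))) u
      (Pi.single a 1) := by
  set d : Fin N → ℝ := Pi.single a 1 with hd
  have h1 : ∀ j, HasDerivAt (fun t : ℝ => -(Complex.I * p * ((u + t • d) j : ℝ)) -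
      s * Complex.log (1 - Complex.I * ((u + t • d) j : ℝ)))
      ((-(Complex.I * p) + s * Complex.I / (1 - Complex.I * u j)) * d j) 0 := by
    intro j
    have h2 : HasDerivAt (fun t : ℝ => (((u + t • d) j : ℝ) : ℂ)) (d j : ℂ) 0 := by
      have h3 : HasDerivAt (fun t : ℝ => u j + t * d j) (d j) 0 := by
        simpa using ((hasDerivAt_id (0 : ℝ)).mul_const (d j)).const_add (u j)
      exact h3.ofReal_comp
    have h4 := (h2.const_mul Complex.I).const_sub 1
    have h5 := (h4.clog_real (by simpa using one_sub_I_mul_mem_slitPlane _)).const_mul (s : ℂ)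
    refine ((h2.const_mul (Complex.I * p)).neg.sub h5).congr_deriv ?_
    simp only [zero_smul, add_zero]
    ring
  have h6 := (HasDerivAt.fun_sum (u := univ) fun j _ => h1 j).cexp
  have e : ∀ u : Fin N → ℝ, ∏ j, weight p s (u j) = Complex.exp (∑ j, (-(Complex.I * p * (u j)) -
      s * Complex.log (1 - Complex.I * (u j)))) := by
    intro u
    rw [Complex.exp_sum]
    rfl
  rw [HasLineDerivAt, e u]
  simp only [e]
  refine h6.congr_deriv ?_
  simp only [zero_smul, add_zero]
  congr 1
  rw [sum_eq_single a]
  · simp [hd]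
  · intro b _ hb
    simp [hd, hb]
  · simp

theorem hasLineDerivAt_linProd_insert {S : Finset (Fin N)} {a : Fin N} (ha : a ∉ S)
    (u : Fin N → ℝ) :
    HasLineDerivAt ℝ (linProd (insert a S)) (-Complex.I * linProd S u) u (Pi.single a 1) := by
  have e : (fun t : ℝ => linProd (insert a S) (u + t • Pi.single a 1)) = fun t : ℝ =>
      (1 - Complex.I * ((u a + t * 1 : ℝ) : ℂ)) * linProd S u := by
    funext t
    rw [linProd, prod_insert ha, linProd]
    congr 1
    · simp
    · refine prod_congr rfl fun j hj => ?_
      have : j ≠ a := fun h => ha (h ▸ hj)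
      simp [this]
  rw [HasLineDerivAt, e]
  have h3 : HasDerivAt (fun t : ℝ => u a + t * 1) 1 0 := by
    simpa using ((hasDerivAt_id (0 : ℝ)).mul_const (1 : ℝ)).const_add (u a)
  have := ((h3.ofReal_comp.const_mul Complex.I).const_sub 1).mul_const (linProd S u)
  exact this.congr_deriv (by simp)

/-- The extra factor `1 - i u_a` cancels the pole of the logarithmic derivative `s i / (1 - i u_a)`
of the weight and gives `i s`; its own derivative contributes `-i`, whence `i (s - 1)`. -/
theorem hasLineDerivAt_ensemble {γ ε : ℝ} (hε : 0 < ε) (p s : ℝ) {S : Finset (Fin N)} {a : Fin N}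
    (ha : a ∉ S) (u : Fin N → ℝ) :
    HasLineDerivAt ℝ (ensemble γ ε p s (linProd (insert a S)))
      (ensemble γ ε p s (fun u => Complex.I * (s - 1) * linProd S u -
        Complex.I * p * linProd (insert a S) u +
        2 * γ * ∑ j, linProd (insert a S) u * regInv ε a j u) u) u (Pi.single a 1) := by
  have h1 := (hasLineDerivAt_regVand (γ := γ) hε a u)
  rw [HasLineDerivAt] at h1
  have h2 := hasLineDerivAt_linProd_insert ha u
  rw [HasLineDerivAt] at h2
  have h3 := hasLineDerivAt_prod_weight p s a u
  rw [HasLineDerivAt] at h3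
  rw [HasLineDerivAt]
  refine (h1.ofReal_comp.mul (h2.mul h3)).congr_deriv ?_
  simp only [Pi.mul_apply, zero_smul, add_zero, ensemble]
  have hne : 1 - Complex.I * (u a : ℂ) ≠ 0 :=
    Complex.slitPlane_ne_zero (one_sub_I_mul_mem_slitPlane _)
  have hlin : linProd (insert a S) u = (1 - Complex.I * u a) * linProd S u := by
    simp only [linProd, prod_insert ha]
  rw [hlin, ← mul_sum]
  push_cast
  field_simp
  ring

theorem norm_linProd_le (S : Finset (Fin N)) (u : Fin N → ℝ) :
    ‖linProd S u‖ ≤ ∏ i, (1 + u i ^ 2) := by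
  rw [linProd, norm_prod]
  have h1 : ∀ i, 1 ≤ 1 + u i ^ 2 := fun i => by nlinarith [sq_nonneg (u i)]
  calc ∏ i ∈ S, ‖1 - Complex.I * (u i : ℂ)‖ ≤ ∏ i ∈ S, (1 + u i ^ 2) := by
        refine prod_le_prod (fun i _ => norm_nonneg _) fun i _ => ?_
        rw [norm_one_sub_I_mul]
        exact Real.rpow_le_self_of_one_le (h1 i) (by norm_num)
    _ ≤ ∏ i, (1 + u i ^ 2) :=
        prod_le_prod_of_subset_of_one_le (subset_univ S) (fun i _ => by positivity)
          fun i _ _ => h1 i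

theorem continuous_linProd (S : Finset (Fin N)) : Continuous (linProd S) := by
  unfold linProd
  fun_prop

theorem continuous_regInv {ε : ℝ} (hε : 0 < ε) (a j : Fin N) : Continuous (regInv ε a j) := by
  unfold regInv
  exact Continuous.div (by fun_prop) (by fun_prop) fun u => by positivity

theorem abs_regInv_le {ε : ℝ} (hε : 0 < ε) (hε1 : ε ≤ 1) (a j : Fin N) (u : Fin N → ℝ) :
    |regInv ε a j u| ≤ ε⁻¹ := by
  have h : 0 < (u a - u j) ^ 2 + ε := by positivity
  rw [regInv, abs_div, abs_of_pos h, div_le_iff₀ h, mul_add, inv_mul_cancel₀ hε.ne']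
  have h1 : 1 ≤ ε⁻¹ := (one_le_inv₀ hε).2 hε1
  have h2 : |u a - u j| ≤ (u a - u j) ^ 2 + 1 := by
    rw [← sq_abs (u a - u j)]
    nlinarith [sq_nonneg (|u a - u j| - 1), abs_nonneg (u a - u j)]
  nlinarith [sq_nonneg (u a - u j), mul_le_mul_of_nonneg_right h1 (sq_nonneg (u a - u j))]

theorem integral_ensemble_add {γ ε p s K L : ℝ} (hγ : 0 < γ) (hε0 : 0 ≤ ε) (hε1 : ε ≤ 1)
    (hs : 2 * γ * N + 4 ≤ s) {q r : (Fin N → ℝ) → ℂ} (hqc : Continuous q) (hrc : Continuous r)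
    (hq : ∀ u, ‖q u‖ ≤ K * ∏ i, (1 + u i ^ 2)) (hr : ∀ u, ‖r u‖ ≤ L * ∏ i, (1 + u i ^ 2)) :
    ∫ u, ensemble γ ε p s (fun u => q u + r u) u =
      (∫ u, ensemble γ ε p s q u) + ∫ u, ensemble γ ε p s r u := by
  rw [← integral_add (integrable_ensemble hγ hε0 hε1 hs hqc hq)
    (integrable_ensemble hγ hε0 hε1 hs hrc hr)]
  refine integral_congr_ae (Eventually.of_forall fun u => ?_)
  simp only [ensemble]
  ring

theorem integral_ensemble_const_mul (γ ε p s : ℝ) (c : ℂ) (q : (Fin N → ℝ) → ℂ) :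
    ∫ u, ensemble γ ε p s (fun u => c * q u) u = c * ∫ u, ensemble γ ε p s q u := by
  rw [← integral_const_mul]
  refine integral_congr_ae (Eventually.of_forall fun u => ?_)
  simp only [ensemble]
  ring

theorem integral_ensemble_sum {γ ε p s : ℝ} (hγ : 0 < γ) (hε0 : 0 ≤ ε) (hε1 : ε ≤ 1)
    (hs : 2 * γ * N + 4 ≤ s) {ι : Type*} (J : Finset ι) {q : ι → (Fin N → ℝ) → ℂ} {K : ι → ℝ}
    (hqc : ∀ j ∈ J, Continuous (q j)) (hq : ∀ j ∈ J, ∀ u, ‖q j u‖ ≤ K j * ∏ i, (1 + u i ^ 2)) :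
    ∫ u, ensemble γ ε p s (fun u => ∑ j ∈ J, q j u) u = ∑ j ∈ J, ∫ u, ensemble γ ε p s (q j) u := by
  rw [← integral_finsetSum J fun j hj => integrable_ensemble hγ hε0 hε1 hs (hqc j hj) (hq j hj)]
  refine integral_congr_ae (Eventually.of_forall fun u => ?_)
  simp only [ensemble, sum_mul, mul_sum]

end Recursion

/-! ### Symmetrized integration by parts -/

section Partition

open Finset

variable {N : ℕ}

theorem linProd_comp_swap {S : Finset (Fin N)} {a j : Fin N} (h : a ∈ S ↔ j ∈ S)
    (u : Fin N → ℝ) : linProd S (u ∘ Equiv.swap a j) = linProd S u := by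
  have hS : S.map (Equiv.swap a j).toEmbedding = S := by
    ext b
    rw [mem_map_equiv, Equiv.symm_swap, Equiv.swap_apply_def]
    split_ifs with h1 h2
    · rw [h1, h]
    · rw [h2, h]
    · rfl
  conv_rhs => rw [← hS]
  simp [linProd, prod_map]

theorem regInv_comp_swap (ε : ℝ) (a j : Fin N) (u : Fin N → ℝ) :
    regInv ε a j (u ∘ Equiv.swap a j) = -regInv ε a j u := by
  simp only [regInv, Function.comp_apply, Equiv.swap_apply_left, Equiv.swap_apply_right]
  rw [← neg_sub (u a) (u j), neg_sq]
  ring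

theorem norm_linProd_mul_regInv_le {ε : ℝ} (hε : 0 < ε) (hε1 : ε ≤ 1) (S : Finset (Fin N))
    (a j : Fin N) (u : Fin N → ℝ) :
    ‖linProd S u * regInv ε a j u‖ ≤ ε⁻¹ * ∏ i, (1 + u i ^ 2) := by
  rw [norm_mul, mul_comm, Complex.norm_real]
  exact mul_le_mul (abs_regInv_le hε hε1 a j u) (norm_linProd_le S u) (norm_nonneg _)
    (by positivity)

theorem continuous_linProd_mul_regInv {ε : ℝ} (hε : 0 < ε) (S : Finset (Fin N)) (a j : Fin N) :
    Continuous fun u => linProd S u * (regInv ε a j u : ℂ) :=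
  (continuous_linProd S).mul (Complex.continuous_ofReal.comp (continuous_regInv hε a j))

/-- When `a` and `j` both index the monomial, exchanging `u_a` and `u_j` changes the sign of the
integrand. -/
theorem integral_ensemble_linProd_insert_mul_regInv_of_mem (γ ε p s : ℝ) {S : Finset (Fin N)}
    {a j : Fin N} (hj : j ∈ S) :
    ∫ u, ensemble γ ε p s (fun u => linProd (insert a S) u * regInv ε a j u) u = 0 := by
  have h := integral_ensemble_comp_swap γ ε p s
    (fun u => linProd (insert a S) u * regInv ε a j u) a j
  have e : ∀ u : Fin N → ℝ, linProd (insert a S) (u ∘ Equiv.swap a j) *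
      (regInv ε a j (u ∘ Equiv.swap a j) : ℂ) = (-1) * (linProd (insert a S) u * regInv ε a j u) := by
    intro u
    rw [linProd_comp_swap (by simp [hj]), regInv_comp_swap]
    push_cast
    ring
  simp only [e] at h
  rw [integral_ensemble_const_mul] at h
  linear_combination (-1 / 2 : ℂ) * h

/-- Adding the integral with `u_a` and `u_j` exchanged replaces `1 - i u_a` by `(1 - i u_a) - (1 - i
u_j) = -i (u_a - u_j)`. This cancels the singularity that `regInv` acquires as `ε → 0`. -/
theorem two_mul_integral_ensemble_linProd_insert_mul_regInv {γ ε p s : ℝ} (hγ : 0 < γ) (hε0 : 0 < ε)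
    (hε1 : ε ≤ 1) (hs : 2 * γ * N + 4 ≤ s) {S : Finset (Fin N)} {a j : Fin N} (ha : a ∉ S)
    (hj : j ∉ S) :
    2 * ∫ u, ensemble γ ε p s (fun u => linProd (insert a S) u * regInv ε a j u) u =
      -Complex.I * ∫ u, ensemble γ ε p s
        (fun u => linProd S u * ((u a - u j) * regInv ε a j u : ℝ)) u := by
  have h := integral_ensemble_comp_swap γ ε p s
    (fun u => linProd (insert a S) u * regInv ε a j u) a j
  have hc := continuous_linProd_mul_regInv hε0 (insert a S) a j
  have hb := norm_linProd_mul_regInv_le hε0 hε1 (insert a S) a j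
  have e1 : ∀ u : Fin N → ℝ, linProd (insert a S) (u ∘ Equiv.swap a j) *
      (regInv ε a j (u ∘ Equiv.swap a j) : ℂ) = -(1 - Complex.I * u j) * linProd S u * regInv ε a j u := by
    intro u
    have : linProd (insert a S) (u ∘ Equiv.swap a j) = (1 - Complex.I * u j) * linProd S u := by
      rw [← linProd_comp_swap (a := a) (j := j) (S := S) (by simp [ha, hj])]
      simp [linProd, prod_insert ha]
    rw [this, regInv_comp_swap]
    push_cast
    ring
  have hc' : Continuous fun u : Fin N → ℝ => linProd (insert a S) (u ∘ Equiv.swap a j) *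
      (regInv ε a j (u ∘ Equiv.swap a j) : ℂ) :=
    hc.comp (by fun_prop : Continuous fun u : Fin N → ℝ => u ∘ Equiv.swap a j)
  have hb' : ∀ u : Fin N → ℝ, ‖linProd (insert a S) (u ∘ Equiv.swap a j) *
      (regInv ε a j (u ∘ Equiv.swap a j) : ℂ)‖ ≤ ε⁻¹ * ∏ i, (1 + u i ^ 2) := by
    intro u
    refine (hb _).trans (le_of_eq ?_)
    congr 1
    exact Equiv.prod_comp (Equiv.swap a j) fun i => 1 + u i ^ 2
  rw [← integral_ensemble_const_mul γ ε p s (-Complex.I), two_mul]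
  nth_rewrite 1 [← h]
  rw [← integral_ensemble_add hγ hε0.le hε1 hs hc' hc hb' hb]
  congr 1
  funext u
  congr 1
  funext u
  have e2 : linProd (insert a S) u = (1 - Complex.I * u a) * linProd S u := prod_insert ha
  rw [e1, e2]
  push_cast
  ring

/-- Integration by parts for the regularized ensemble, after symmetrization. -/
theorem integral_ensemble_linProd_insert_reg {γ ε p s : ℝ} (hγ : 0 < γ) (hε0 : 0 < ε)
    (hε1 : ε ≤ 1) (hs : 2 * γ * N + 4 ≤ s) {S : Finset (Fin N)} {a : Fin N} (ha : a ∉ S) :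
    p * ∫ u, ensemble γ ε p s (linProd (insert a S)) u =
      (s - 1) * (∫ u, ensemble γ ε p s (linProd S) u) - γ * ∑ j ∈ (insert a S)ᶜ,
        ∫ u, ensemble γ ε p s (fun u => linProd S u * ((u a - u j) * regInv ε a j u : ℝ)) u := by
  have hl : ∀ (T : Finset (Fin N)) (c : ℂ) u, ‖c * linProd T u‖ ≤ ‖c‖ * ∏ i, (1 + u i ^ 2) := by
    intro T c u
    rw [norm_mul]
    exact mul_le_mul_of_nonneg_left (norm_linProd_le T u) (norm_nonneg _)
  have hl1 : ∀ (T : Finset (Fin N)) u, ‖linProd T u‖ ≤ 1 * ∏ i, (1 + u i ^ 2) := by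
    intro T u
    rw [one_mul]
    exact norm_linProd_le T u
  have hcl : ∀ (T : Finset (Fin N)) (c : ℂ), Continuous fun u => c * linProd T u := fun T c =>
    continuous_const.mul (continuous_linProd T)
  have hcs : Continuous fun u : Fin N → ℝ => ∑ j, linProd (insert a S) u * (regInv ε a j u : ℂ) :=
    continuous_finsetSum _ fun j _ => continuous_linProd_mul_regInv hε0 (insert a S) a j
  have hbs : ∀ u : Fin N → ℝ, ‖∑ j, linProd (insert a S) u * (regInv ε a j u : ℂ)‖ ≤
      (N * ε⁻¹) * ∏ i, (1 + u i ^ 2) := by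
    intro u
    refine (norm_sum_le _ _).trans ((sum_le_sum fun j _ =>
      norm_linProd_mul_regInv_le hε0 hε1 (insert a S) a j u).trans (le_of_eq ?_))
    simp
    ring
  have hcs2 : Continuous fun u : Fin N → ℝ => (2 * γ : ℂ) * ∑ j, linProd (insert a S) u *
      (regInv ε a j u : ℂ) := continuous_const.mul hcs
  have hbs2 : ∀ u : Fin N → ℝ, ‖(2 * γ : ℂ) * ∑ j, linProd (insert a S) u * (regInv ε a j u : ℂ)‖ ≤
      (‖(2 * γ : ℂ)‖ * (N * ε⁻¹)) * ∏ i, (1 + u i ^ 2) := by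
    intro u
    rw [norm_mul, mul_assoc]
    exact mul_le_mul_of_nonneg_left (hbs u) (norm_nonneg _)
  have hc12 : Continuous fun u : Fin N → ℝ => Complex.I * (s - 1) * linProd S u +
      -(Complex.I * p) * linProd (insert a S) u := (hcl _ _).add (hcl _ _)
  have hb12 : ∀ u : Fin N → ℝ, ‖Complex.I * (s - 1) * linProd S u +
      -(Complex.I * p) * linProd (insert a S) u‖ ≤
      (‖Complex.I * ((s : ℂ) - 1)‖ + ‖-(Complex.I * (p : ℂ))‖) * ∏ i, (1 + u i ^ 2) := by
    intro u
    rw [add_mul]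
    exact (norm_add_le _ _).trans (add_le_add (hl _ _ u) (hl _ _ u))
  have key := integral_eq_zero_of_hasLineDerivAt
    (integrable_ensemble hγ hε0.le hε1 hs (continuous_linProd (insert a S)) (hl1 _))
    (f' := ensemble γ ε p s (fun u => (Complex.I * (s - 1) * linProd S u +
      -(Complex.I * p) * linProd (insert a S) u) +
        2 * γ * ∑ j, linProd (insert a S) u * regInv ε a j u))
    (integrable_ensemble (K := (‖Complex.I * ((s : ℂ) - 1)‖ + ‖-(Complex.I * (p : ℂ))‖) +
      (‖(2 * γ : ℂ)‖ * (N * ε⁻¹))) hγ hε0.le hε1 hs (hc12.add hcs2) (fun u => by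
        rw [add_mul]
        exact (norm_add_le _ _).trans (add_le_add (hb12 u) (hbs2 u))))
    (v := Pi.single a 1) (fun u => by
      have h := hasLineDerivAt_ensemble (γ := γ) hε0 p s ha u
      have e : ∀ u : Fin N → ℝ, Complex.I * (s - 1) * linProd S u -
        Complex.I * p * linProd (insert a S) u +
        2 * γ * ∑ j, linProd (insert a S) u * regInv ε a j u = (Complex.I * (s - 1) * linProd S u +
          -(Complex.I * p) * linProd (insert a S) u) +
        2 * γ * ∑ j, linProd (insert a S) u * regInv ε a j u := fun u => by ring
      simpa only [e] using h)
  rw [integral_ensemble_add hγ hε0.le hε1 hs hc12 hcs2 hb12 hbs2,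
    integral_ensemble_add hγ hε0.le hε1 hs (hcl _ _) (hcl _ _) (hl _ _) (hl _ _),
    integral_ensemble_const_mul, integral_ensemble_const_mul, integral_ensemble_const_mul,
    integral_ensemble_sum hγ hε0.le hε1 hs univ (K := fun _ => ε⁻¹)
      (fun j _ => continuous_linProd_mul_regInv hε0 (insert a S) a j)
      (fun j _ => norm_linProd_mul_regInv_le hε0 hε1 (insert a S) a j)] at key
  have hsum : 2 * ∑ j, ∫ u, ensemble γ ε p s (fun u => linProd (insert a S) u * regInv ε a j u) u =
      -Complex.I * ∑ j ∈ (insert a S)ᶜ, ∫ u, ensemble γ ε p s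
        (fun u => linProd S u * ((u a - u j) * regInv ε a j u : ℝ)) u := by
    -- Indices in `S` vanish by antisymmetry and `j = a` because `regInv ε a a = 0`.
    rw [mul_sum, mul_sum, ← sum_add_sum_compl (insert a S), sum_eq_zero, zero_add]
    · refine sum_congr rfl fun j hj => ?_
      exact two_mul_integral_ensemble_linProd_insert_mul_regInv hγ hε0 hε1 hs ha
        fun h => (mem_compl.1 hj) (mem_insert_of_mem h)
    · intro j hj
      rcases mem_insert.1 hj with rfl | hj
      · simp [regInv, ensemble]
      · rw [integral_ensemble_linProd_insert_mul_regInv_of_mem γ ε p s hj, mul_zero]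
  apply mul_left_cancel₀ Complex.I_ne_zero
  linear_combination (-1 : ℂ) * key + (γ : ℂ) * hsum

end Partition

/-! ### Removing the regularization; recursion in `s` and equation in `p` -/

section PartitionFunction

open Finset

variable {N : ℕ}

theorem tendsto_regVand {γ : ℝ} (hγ : 0 < γ) (u : Fin N → ℝ) :
    Tendsto (fun ε => regVand γ ε u) (𝓝[>] 0) (𝓝 (regVand γ 0 u)) := by
  have : Continuous fun ε => regVand γ ε u := by
    unfold regVand
    refine continuous_finsetProd _ fun i _ => continuous_finsetProd _ fun j _ => ?_
    split_ifs
    · fun_prop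
    · exact Continuous.rpow_const (by fun_prop) fun _ => Or.inr (by positivity)
  exact (this.tendsto 0).mono_left nhdsWithin_le_nhds

theorem regVand_zero_of_eq {γ : ℝ} (hγ : 0 < γ) {u : Fin N → ℝ} {a j : Fin N} (haj : a ≠ j)
    (h : u a = u j) : regVand γ 0 u = 0 := by
  refine prod_eq_zero (mem_univ a) (prod_eq_zero (mem_univ j) ?_)
  rw [if_neg haj, h, sub_self]
  simp [Real.zero_rpow (half_pos hγ).ne']

/-- Convergence is asked of the product with `regVand` because the test function need not tend to
`q₀` where two coordinates coincide; there the vanishing of `regVand γ 0` takes over. -/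
theorem tendsto_integral_ensemble {γ p s : ℝ} (hγ : 0 < γ) (hs : 2 * γ * N + 4 ≤ s)
    {q : ℝ → (Fin N → ℝ) → ℂ} {q₀ : (Fin N → ℝ) → ℂ} (hqc : ∀ ε, 0 < ε → Continuous (q ε))
    (hq : ∀ ε, 0 < ε → ∀ u, ‖q ε u‖ ≤ ∏ i, (1 + u i ^ 2))
    (hlim : ∀ u, Tendsto (fun ε => (regVand γ ε u : ℂ) * q ε u) (𝓝[>] 0)
      (𝓝 (regVand γ 0 u * q₀ u))) :
    Tendsto (fun ε => ∫ u, ensemble γ ε p s (q ε) u) (𝓝[>] 0)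
      (𝓝 (∫ u, ensemble γ 0 p s q₀ u)) := by
  refine tendsto_integral_filter_of_dominated_convergence
    (fun u => 1 * ((2 : ℝ) ^ (γ * N)) ^ N * ∏ i, (1 + u i ^ 2)⁻¹) ?_ ?_
    (integrable_prod_inv_one_add_sq.const_mul _) (Eventually.of_forall fun u => ?_)
  · filter_upwards [self_mem_nhdsWithin] with ε hε
    exact (continuous_ensemble hγ ε p s (hqc ε hε)).aestronglyMeasurable
  · filter_upwards [Ioc_mem_nhdsGT (show (0 : ℝ) < 1 by norm_num)] with ε hε
    exact Eventually.of_forall fun u => norm_ensemble_le hγ hε.1.le hε.2 hs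
      (by rw [one_mul]; exact hq ε hε.1 u)
  · simp only [ensemble, ← mul_assoc]
    exact (hlim u).mul_const _

/-- As `ε → 0`, `(u_a - u_j) * regInv ε a j u` tends to `1` off the hyperplane `u_a = u_j`, so each
of the `N - (#S + 1)` interaction integrals tends to the integral of `linProd S` itself. -/
theorem integral_ensemble_linProd_insert {γ p s : ℝ} (hγ : 0 < γ) (hs : 2 * γ * N + 4 ≤ s)
    {S : Finset (Fin N)} {a : Fin N} (ha : a ∉ S) :
    p * ∫ u, ensemble γ 0 p s (linProd (insert a S)) u =
      (s - 1 - γ * (N - (#S + 1))) * ∫ u, ensemble γ 0 p s (linProd S) u := by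
  have hT : ∀ T : Finset (Fin N), Tendsto (fun ε => ∫ u, ensemble γ ε p s (linProd T) u) (𝓝[>] 0)
      (𝓝 (∫ u, ensemble γ 0 p s (linProd T) u)) := fun T =>
    tendsto_integral_ensemble hγ hs (fun _ _ => continuous_linProd T)
      (fun _ _ => norm_linProd_le T)
      fun u => ((Complex.continuous_ofReal.tendsto _).comp (tendsto_regVand hγ u)).mul_const _
  have hR : ∀ j ∈ (insert a S)ᶜ, Tendsto (fun ε => ∫ u, ensemble γ ε p s
      (fun u => linProd S u * ((u a - u j) * regInv ε a j u : ℝ)) u) (𝓝[>] 0)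
      (𝓝 (∫ u, ensemble γ 0 p s (linProd S) u)) := by
    intro j hj
    have haj : a ≠ j := fun h => (mem_compl.1 hj) (h ▸ mem_insert_self a S)
    refine tendsto_integral_ensemble hγ hs (fun ε hε => ?_) (fun ε hε u => ?_) fun u => ?_
    · have := continuous_regInv hε a j
      exact (continuous_linProd S).mul (Complex.continuous_ofReal.comp
        (((continuous_apply a).sub (continuous_apply j)).mul this))
    · rw [norm_mul, Complex.norm_real]
      refine (mul_le_of_le_one_right (norm_nonneg _) ?_).trans (norm_linProd_le S u)
      have h : 0 < (u a - u j) ^ 2 + ε := by positivity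
      have e : (u a - u j) * regInv ε a j u = (u a - u j) ^ 2 / ((u a - u j) ^ 2 + ε) := by
        rw [regInv]; ring
      rw [e, Real.norm_of_nonneg (by positivity), div_le_one h]
      linarith
    · by_cases h : u a = u j
      · rw [regVand_zero_of_eq hγ haj h]
        simp [h]
      · have hne : u a - u j ≠ 0 := sub_ne_zero.2 h
        have h1 : Tendsto (fun ε => (u a - u j) * regInv ε a j u) (𝓝[>] 0) (𝓝 1) := by
          have hc : ContinuousAt (fun ε => (u a - u j) * regInv ε a j u) 0 := by
            unfold regInv
            refine continuousAt_const.mul (ContinuousAt.div (by fun_prop) (by fun_prop) ?_)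
            simpa using hne
          have := hc.tendsto.mono_left (nhdsWithin_le_nhds (s := Set.Ioi (0 : ℝ)))
          convert this using 2
          simp only [regInv, add_zero]
          field_simp
        have h2 := ((Complex.continuous_ofReal.tendsto _).comp (tendsto_regVand hγ u)).mul
          (((Complex.continuous_ofReal.tendsto _).comp h1).const_mul (linProd S u))
        simpa using h2
  have h1 := (hT (insert a S)).const_mul (p : ℂ)
  have h2 := ((hT S).const_mul ((s : ℂ) - 1)).sub ((tendsto_finsetSum _ hR).const_mul (γ : ℂ))
  have h3 := h2.congr' (f₂ := fun ε => (p : ℂ) * ∫ u, ensemble γ ε p s (linProd (insert a S)) u) (by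
    filter_upwards [Ioc_mem_nhdsGT (show (0 : ℝ) < 1 by norm_num)] with ε hε
    exact (integral_ensemble_linProd_insert_reg hγ hε.1 hε.2 hs ha).symm)
  rw [tendsto_nhds_unique h1 h3, sum_const, card_compl, card_insert_of_notMem ha, nsmul_eq_mul,
    Fintype.card_fin, Nat.cast_sub]
  · push_cast
    ring
  · rw [← card_insert_of_notMem ha]
    simpa using card_le_univ (insert a S)

/-- The partition function with frequency `p` and exponent `s`. -/
noncomputable def partitionFn (N : ℕ) (γ p s : ℝ) : ℂ :=
  ∫ u : Fin N → ℝ, ensemble γ 0 p s (fun _ => 1) u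

theorem linProd_empty : linProd (∅ : Finset (Fin N)) = fun _ => 1 := by
  funext u
  simp [linProd]

theorem pow_card_mul_integral_ensemble_linProd {γ p s : ℝ} (hγ : 0 < γ) (hs : 2 * γ * N + 4 ≤ s)
    (S : Finset (Fin N)) :
    (p : ℂ) ^ #S * ∫ u, ensemble γ 0 p s (linProd S) u =
      (∏ k ∈ range #S, ((s : ℂ) - 1 - γ * (N - (k + 1)))) * partitionFn N γ p s := by
  induction S using Finset.induction_on with
  | empty => simp [linProd_empty, partitionFn]
  | insert a S ha ih =>
    rw [card_insert_of_notMem ha, pow_succ, mul_assoc, integral_ensemble_linProd_insert hγ hs ha,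
      prod_range_succ]
    linear_combination ((s : ℂ) - 1 - γ * (N - (#S + 1))) * ih

theorem lin_mul_weight (p s x : ℝ) : (1 - Complex.I * x) * weight p (s + 1) x = weight p s x := by
  have hne : 1 - Complex.I * (x : ℂ) ≠ 0 :=
    Complex.slitPlane_ne_zero (one_sub_I_mul_mem_slitPlane _)
  have h : weight p s x = Complex.exp (Complex.log (1 - Complex.I * x)) * weight p (s + 1) x := by
    rw [weight, weight, ← Complex.exp_add]
    congr 1
    push_cast
    ring
  rw [h, Complex.exp_log hne]

/-- The recursion in the exponent. -/
theorem pow_mul_partitionFn {γ p s : ℝ} (hγ : 0 < γ) (hs : 2 * γ * N + 4 ≤ s) :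
    (p : ℂ) ^ N * partitionFn N γ p s =
      (∏ j ∈ range N, ((s : ℂ) - γ * j)) * partitionFn N γ p (s + 1) := by
  -- At exponent `s + 1`, the full product of the factors `1 - i u_j` lowers the exponent back to
  -- `s`.
  have h := pow_card_mul_integral_ensemble_linProd (N := N) (p := p) (s := s + 1) hγ
    (by linarith) univ
  rw [card_univ, Fintype.card_fin] at h
  have e : ∀ u : Fin N → ℝ, ensemble γ 0 p (s + 1) (linProd univ) u =
      ensemble γ 0 p s (fun _ => 1) u := by
    intro u
    simp only [ensemble, linProd, ← prod_mul_distrib, lin_mul_weight, one_mul]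
  simp only [e] at h
  rw [partitionFn, h, ← prod_range_reflect]
  congr 1
  refine prod_congr rfl fun j hj => ?_
  have hj' : j + 1 ≤ N := mem_range.1 hj
  rw [show N - 1 - j = N - (j + 1) by omega, Nat.cast_sub hj']
  push_cast
  ring

/-- Differentiation brings down `∑ (-i u_j) = ∑ (1 - i u_j) - N`, and the relation for the
singletons `{j}` evaluates each summand. -/
theorem hasDerivAt_partitionFn {γ p s : ℝ} (hγ : 0 < γ) (hp : 0 < p) (hs : 2 * γ * N + 4 ≤ s) :
    HasDerivAt (fun p => partitionFn N γ p s)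
      ((N * ((s - 1 - γ * (N - 1)) / p - 1)) * partitionFn N γ p s) p := by
  have hq1 : ∀ u : Fin N → ℝ, ‖∑ j, -(Complex.I * (u j : ℂ))‖ ≤ (N : ℝ) * ∏ i, (1 + u i ^ 2) := by
    intro u
    have hj : ∀ j, ‖-(Complex.I * (u j : ℂ))‖ ≤ ∏ i, (1 + u i ^ 2) := by
      intro j
      have h1 : |u j| ≤ 1 + u j ^ 2 := by
        rw [← sq_abs (u j)]
        nlinarith [sq_nonneg (|u j| - 1), abs_nonneg (u j)]
      have h2 : 1 + u j ^ 2 ≤ ∏ i, (1 + u i ^ 2) := by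
        have := prod_le_prod_of_subset_of_one_le (s := {j}) (t := univ) (f := fun i => 1 + u i ^ 2)
          (subset_univ _) (fun i _ => by positivity)
          (fun i _ _ => by nlinarith [sq_nonneg (u i)])
        simpa using this
      simpa using h1.trans h2
    refine (norm_sum_le _ _).trans ((sum_le_sum fun j _ => hj j).trans (le_of_eq ?_))
    simp
  have hq0 : ∀ u : Fin N → ℝ, ‖(1 : ℂ)‖ ≤ 1 * ∏ i, (1 + u i ^ 2) := by
    intro u
    have := norm_linProd_le ∅ u
    rw [linProd_empty] at this
    rwa [one_mul]
  have hw : ∀ (x : ℝ) (p : ℝ), HasDerivAt (fun p => weight p s x) (weight p s x * -(Complex.I * x)) p := by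
    intro x p
    have h1 : HasDerivAt (fun p : ℝ => -(Complex.I * p * x) - s * Complex.log (1 - Complex.I * x))
        (-(Complex.I * x)) p := by
      have h2 := ((((hasDerivAt_id p).ofReal_comp.const_mul Complex.I).mul_const (x : ℂ)).neg).sub_const
        (s * Complex.log (1 - Complex.I * x))
      simpa using h2
    exact h1.cexp
  have hens : ∀ (u : Fin N → ℝ) (p : ℝ), HasDerivAt (fun p => ensemble γ 0 p s (fun _ => 1) u)
      (ensemble γ 0 p s (fun u => ∑ j, -(Complex.I * (u j : ℂ))) u) p := by
    intro u p
    have h1 : HasDerivAt (fun p => ∏ j, weight p s (u j))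
        ((∑ j, -(Complex.I * (u j : ℂ))) * ∏ j, weight p s (u j)) p := by
      refine (HasDerivAt.fun_finsetProd fun j _ => hw (u j) p).congr_deriv ?_
      rw [sum_mul]
      refine sum_congr rfl fun j _ => ?_
      rw [smul_eq_mul, ← prod_erase_mul univ _ (mem_univ j)]
      ring
    simp only [ensemble, one_mul]
    exact h1.const_mul _
  have hcq : Continuous fun u : Fin N → ℝ => ∑ j, -(Complex.I * (u j : ℂ)) := by fun_prop
  have hd := hasDerivAt_integral_of_dominated_loc_of_deriv_le
    (μ := (volume : Measure (Fin N → ℝ)))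
    (F := fun p u => ensemble γ 0 p s (fun _ => 1) u)
    (F' := fun p u => ensemble γ 0 p s (fun u => ∑ j, -(Complex.I * (u j : ℂ))) u) (x₀ := p)
    (s := Set.univ) (bound := fun u => N * ((2 : ℝ) ^ (γ * N)) ^ N * ∏ i, (1 + u i ^ 2)⁻¹)
    univ_mem
    (Eventually.of_forall fun p => (continuous_ensemble hγ 0 p s continuous_const).aestronglyMeasurable)
    (integrable_ensemble hγ le_rfl zero_le_one hs continuous_const hq0)
    (continuous_ensemble hγ 0 p s hcq).aestronglyMeasurable
    (Eventually.of_forall fun u p _ => norm_ensemble_le hγ le_rfl zero_le_one hs (hq1 u))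
    (integrable_prod_inv_one_add_sq.const_mul _)
    (Eventually.of_forall fun u p _ => hens u p)
  refine hd.2.congr_deriv ?_
  have e : ∀ u : Fin N → ℝ, ∑ j, -(Complex.I * (u j : ℂ)) =
      (∑ j, linProd {j} u) + (-(N : ℂ)) * 1 := by
    intro u
    simp [linProd, sum_neg_distrib, sum_sub_distrib]
    ring
  have hl1 : ∀ (T : Finset (Fin N)) u, ‖linProd T u‖ ≤ 1 * ∏ i, (1 + u i ^ 2) := by
    intro T u
    rw [one_mul]
    exact norm_linProd_le T u
  simp only [e]
  rw [integral_ensemble_add (K := N) (L := N) hγ le_rfl zero_le_one hs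
    (continuous_finsetSum _ fun j _ => continuous_linProd {j}) continuous_const
    (fun u => (norm_sum_le _ _).trans ((sum_le_sum fun j _ => norm_linProd_le {j} u).trans
      (le_of_eq (by simp))))
    (fun u => by
      rw [norm_mul]
      refine mul_le_mul (by simp) ?_ (norm_nonneg _) (Nat.cast_nonneg N)
      simpa only [one_mul] using hq0 u),
    integral_ensemble_const_mul,
    integral_ensemble_sum hγ le_rfl zero_le_one hs univ (K := fun _ => 1)
      (fun j _ => continuous_linProd {j}) (fun j _ => hl1 {j})]
  have hj : ∀ j : Fin N, ∫ u, ensemble γ 0 p s (linProd {j}) u =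
      (s - 1 - γ * (N - 1)) / p * partitionFn N γ p s := by
    intro j
    have h := pow_card_mul_integral_ensemble_linProd (N := N) (p := p) (s := s) hγ hs {j}
    simp only [card_singleton, pow_one, prod_range_one, Nat.cast_zero, zero_add] at h
    have hp' : (p : ℂ) ≠ 0 := by exact_mod_cast hp.ne'
    field_simp
    linear_combination h
  simp only [hj, sum_const, card_univ, Fintype.card_fin, nsmul_eq_mul]
  rw [partitionFn]
  ring

/-- The dependence of the partition function on the frequency. -/
theorem partitionFn_eq_exp_mul {γ p p' s : ℝ} (hγ : 0 < γ) (hp : 0 < p) (hp' : 0 < p')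
    (hs : 2 * γ * N + 4 ≤ s) :
    partitionFn N γ p' s = (Real.exp (N * ((s - 1 - γ * (N - 1)) * (Real.log p' - Real.log p) -
      (p' - p))) : ℂ) * partitionFn N γ p s := by
  set κ : ℝ := s - 1 - γ * (N - 1) with hκ
  -- In the variable `x = log p` the equation reads `Z' = N (κ - e^x) Z`; multiplying by the
  -- integrating factor gives a constant on all of `ℝ`.
  have hG : ∀ x : ℝ, HasDerivAt (fun x : ℝ => partitionFn N γ (Real.exp x) s *
      (Real.exp (-(N * (κ * x - Real.exp x))) : ℂ)) 0 x := by
    intro x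
    have h1 := (hasDerivAt_partitionFn (N := N) hγ (Real.exp_pos x) hs).scomp x (Real.hasDerivAt_exp x)
    have h2 : HasDerivAt (fun x : ℝ => Real.exp (-(N * (κ * x - Real.exp x))))
        (Real.exp (-(N * (κ * x - Real.exp x))) * -(N * (κ - Real.exp x))) x := by
      have h3 : HasDerivAt (fun x : ℝ => -(N * (κ * x - Real.exp x))) (-(N * (κ - Real.exp x))) x := by
        exact ((((hasDerivAt_id x).const_mul κ).sub (Real.hasDerivAt_exp x)).const_mul
          (N : ℝ)).neg.congr_deriv (by simp)
      exact h3.exp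
    refine (h1.mul h2.ofReal_comp).congr_deriv ?_
    have hne : (Real.exp x : ℂ) ≠ 0 := by exact_mod_cast (Real.exp_pos x).ne'
    simp only [Function.comp_apply, hκ]
    rw [Complex.real_smul]
    push_cast
    push_cast at hne
    field_simp
    ring
  have hconst := is_const_of_deriv_eq_zero (fun x => (hG x).differentiableAt)
    (fun x => (hG x).deriv) (Real.log p') (Real.log p)
  simp only [Real.exp_log hp, Real.exp_log hp'] at hconst
  have e1 : (Real.exp (N * (κ * (Real.log p' - Real.log p) - (p' - p))) : ℂ) =
      Real.exp (-(N * (κ * Real.log p - p))) * Real.exp (N * (κ * Real.log p' - p')) := by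
    rw [← Complex.ofReal_mul, ← Real.exp_add]
    congr 2
    ring
  have e2 : (Real.exp (-(N * (κ * Real.log p' - p'))) : ℂ) * Real.exp (N * (κ * Real.log p' - p')) = 1 := by
    rw [← Complex.ofReal_mul, ← Real.exp_add]
    simp
  rw [e1]
  linear_combination (Real.exp (N * (κ * Real.log p' - p')) : ℂ) * hconst - partitionFn N γ p' s * e2

end PartitionFunction

/-! ### Scaling, the limit `t → 0⁺`, and the difference equation for `W` -/

section NormalizedIntegral

open Finset

variable {N : ℕ}

theorem regVand_zero (γ : ℝ) (u : Fin N → ℝ) : regVand γ 0 u = |vand u| ^ (2 * γ) := by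
  have h1 : regVand γ 0 u = ∏ i, ∏ j ∈ ({i}ᶜ : Finset (Fin N)), |u i - u j| ^ γ := by
    refine prod_congr rfl fun i _ => ?_
    rw [← prod_mul_prod_compl {i}, prod_singleton, if_pos rfl, one_mul]
    refine prod_congr rfl fun j hj => ?_
    have hij : i ≠ j := fun h => (mem_compl.1 hj) (by simp [h])
    rw [if_neg hij, add_zero, ← sq_abs, ← Real.rpow_natCast, ← Real.rpow_mul (abs_nonneg _)]
    congr 1
    push_cast
    ring
  rw [h1, ← prod_prod_Ioi_mul_eq_prod_prod_off_diag, vand, abs_prod,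
    ← Real.finsetProd_rpow _ _ fun i _ => abs_nonneg _]
  refine prod_congr rfl fun i _ => ?_
  rw [abs_prod, ← Real.finsetProd_rpow _ _ fun i _ => abs_nonneg _]
  refine prod_congr rfl fun j _ => ?_
  rw [abs_sub_comm (u i) (u j), two_mul]
  rcases (abs_nonneg (u j - u i)).eq_or_lt with h | h
  · rw [← h]
    rcases eq_or_ne γ 0 with rfl | hγ
    · simp
    · rw [Real.zero_rpow hγ, Real.zero_rpow (by simpa using hγ), mul_zero]
  · rw [Real.rpow_add h]

theorem regVand_zero_smul (γ : ℝ) {r : ℝ} (hr : 0 < r) (u : Fin N → ℝ) :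
    regVand γ 0 (r • u) = r ^ (γ * (N * (N - 1))) * regVand γ 0 u := by
  have hone : ∀ i : Fin N, (∏ j, if i = j then (1 : ℝ) else r ^ γ) = r ^ (γ * (N - 1)) := by
    intro i
    have h1 : r ^ γ * (∏ j, if i = j then (1 : ℝ) else r ^ γ) = (r ^ γ) ^ N := by
      have h2 : (∏ j, if i = j then r ^ γ else (1 : ℝ)) = r ^ γ := by simp
      nth_rewrite 1 [← h2]
      rw [← prod_mul_distrib]
      have h3 : ∀ j, ((if i = j then r ^ γ else (1 : ℝ)) * if i = j then (1 : ℝ) else r ^ γ) = r ^ γ := by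
        intro j
        split_ifs <;> simp
      simp [h3]
    have h4 : 0 < r ^ γ := Real.rpow_pos_of_pos hr γ
    apply mul_left_cancel₀ h4.ne'
    rw [h1, ← Real.rpow_add hr, ← Real.rpow_natCast, ← Real.rpow_mul hr.le]
    congr 1
    ring
  have h5 : regVand γ 0 (r • u) =
      ∏ i, ∏ j, ((if i = j then (1 : ℝ) else r ^ γ) *
        (if i = j then 1 else ((u i - u j) ^ 2 + 0) ^ (γ / 2))) := by
    refine prod_congr rfl fun i _ => prod_congr rfl fun j _ => ?_
    split_ifs
    · simp
    · have e : ((r • u) i - (r • u) j) ^ 2 + 0 = r ^ 2 * ((u i - u j) ^ 2 + 0) := by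
        simp only [Pi.smul_apply, smul_eq_mul]
        ring
      rw [e, Real.mul_rpow (by positivity) (by positivity), ← Real.rpow_natCast r 2,
        ← Real.rpow_mul hr.le]
      congr 2
      push_cast
      ring
  rw [h5]
  simp only [prod_mul_distrib, hone]
  rw [regVand, prod_const, card_univ, Fintype.card_fin, ← Real.rpow_natCast, ← Real.rpow_mul hr.le]
  congr 2
  ring

theorem exp_mul_cpow_eq_weight {γ t : ℝ} (ht : 0 < t) (x : ℝ) :
    Complex.exp (-(Complex.I * (γ : ℂ) * (x : ℂ) / ((√t : ℝ) : ℂ))) *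
      (1 - Complex.I * ((√t : ℝ) : ℂ) * (x : ℂ)) ^ (-((γ : ℂ) / (t : ℂ))) =
      weight (γ / t) (γ / t) (√t * x) := by
  have hs : (0 : ℝ) < √t := Real.sqrt_pos.2 ht
  have hsq : ((√t : ℝ) : ℂ) * ((√t : ℝ) : ℂ) = (t : ℂ) := by
    rw [← Complex.ofReal_mul, Real.mul_self_sqrt ht.le]
  have hs0 : ((√t : ℝ) : ℂ) ≠ 0 := by exact_mod_cast hs.ne'
  have e : 1 - Complex.I * ((√t : ℝ) : ℂ) * (x : ℂ) = 1 - Complex.I * ((√t * x : ℝ) : ℂ) := by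
    push_cast; ring
  rw [e, Complex.cpow_def_of_ne_zero (Complex.slitPlane_ne_zero (one_sub_I_mul_mem_slitPlane _)),
    ← Complex.exp_add, weight]
  congr 1
  push_cast
  rw [← hsq]
  field_simp
  ring

theorem numIntegrand_eq {γ t : ℝ} (ht : 0 < t) (v : Fin N → ℝ) :
    numIntegrand γ N t v = ((√t ^ (-(γ * (N * (N - 1)))) : ℝ) : ℂ) *
      ensemble γ 0 (γ / t) (γ / t) (fun _ => 1) (√t • v) := by
  have hs : (0 : ℝ) < √t := Real.sqrt_pos.2 ht
  rw [numIntegrand, ← regVand_zero, ensemble, regVand_zero_smul γ hs, one_mul, ← mul_assoc,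
    ← Complex.ofReal_mul, ← mul_assoc, ← Real.rpow_add hs, neg_add_cancel, Real.rpow_zero, one_mul]
  congr 1
  exact prod_congr rfl fun j _ => exp_mul_cpow_eq_weight ht (v j)

theorem integrable_numIntegrand {γ t : ℝ} (hγ : 0 < γ) (ht : 0 < t)
    (hs : 2 * γ * N + 4 ≤ γ / t) : Integrable (numIntegrand γ N t) := by
  have h : Integrable (ensemble (N := N) γ 0 (γ / t) (γ / t) fun _ => 1) :=
    integrable_ensemble (K := 1) hγ le_rfl zero_le_one hs continuous_const fun u => by
      have := norm_linProd_le ∅ u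
      rw [linProd_empty] at this
      rwa [one_mul]
  have h2 := (h.comp_smul (Real.sqrt_pos.2 ht).ne').const_mul
    ((√t ^ (-(γ * (N * (N - 1)))) : ℝ) : ℂ)
  exact h2.congr (Eventually.of_forall fun v => (numIntegrand_eq ht v).symm)

theorem integral_numIntegrand {γ t : ℝ} (ht : 0 < t) :
    ∫ v : Fin N → ℝ, numIntegrand γ N t v =
      ((√t ^ (-(γ * (N * (N - 1)) + N)) : ℝ) : ℂ) * partitionFn N γ (γ / t) (γ / t) := by
  have hs : (0 : ℝ) < √t := Real.sqrt_pos.2 ht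
  simp only [numIntegrand_eq ht]
  rw [integral_const_mul, Measure.integral_comp_smul_of_nonneg _ _ _ (hR := hs.le),
    Module.finrank_fin_fun, Complex.real_smul, ← mul_assoc, ← Complex.ofReal_mul, neg_add,
    Real.rpow_add hs, Real.rpow_neg hs.le (N : ℝ), Real.rpow_natCast, partitionFn]

theorem norm_numIntegrand {γ t : ℝ} (ht : 0 < t) (v : Fin N → ℝ) :
    ‖numIntegrand γ N t v‖ = |vand v| ^ (2 * γ) * ∏ j, (1 + t * v j ^ 2) ^ (-(γ / t) / 2) := by
  rw [numIntegrand, norm_mul, Complex.norm_real, Real.norm_of_nonneg (by positivity), norm_prod]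
  congr 1
  refine prod_congr rfl fun j _ => ?_
  rw [exp_mul_cpow_eq_weight ht, norm_weight, mul_pow, Real.sq_sqrt ht.le]

/-- Bernoulli's inequality with exponent `t / t₀ ≤ 1`. The modulus of the numerator thus grows with
`t`, so a single `t₀` dominates all smaller `t`. -/
theorem one_add_rpow_le {γ t t₀ y : ℝ} (hγ : 0 < γ) (ht : 0 < t) (htt : t ≤ t₀) (hy : 0 ≤ y) :
    (1 + t * y) ^ (-(γ / t) / 2) ≤ (1 + t₀ * y) ^ (-(γ / t₀) / 2) := by
  have ht0 : 0 < t₀ := ht.trans_le htt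
  have h1 : (1 + t₀ * y) ^ (t / t₀) ≤ 1 + t * y := by
    have := rpow_one_add_le_one_add_mul_self (s := t₀ * y) (p := t / t₀)
      (by linarith [mul_nonneg ht0.le hy]) (by positivity) ((div_le_one ht0).2 htt)
    have e : t / t₀ * (t₀ * y) = t * y := by field_simp
    rwa [e] at this
  have hpos : 0 < 1 + t₀ * y := by positivity
  have h2 := Real.rpow_le_rpow_of_nonpos (Real.rpow_pos_of_pos hpos _) h1
    (show -(γ / t) / 2 ≤ 0 by
      have : 0 < γ / t := by positivity
      linarith)
  rw [← Real.rpow_mul hpos.le] at h2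
  have e : t / t₀ * (-(γ / t) / 2) = -(γ / t₀) / 2 := by field_simp
  rwa [e] at h2

theorem exp_neg_le_one_add_rpow {γ t y : ℝ} (hγ : 0 < γ) (ht : 0 < t) (hy : 0 ≤ y) :
    Real.exp (-(γ * y) / 2) ≤ (1 + t * y) ^ (-(γ / t) / 2) := by
  have hpos : 0 < 1 + t * y := by positivity
  have h1 : 1 + t * y ≤ Real.exp (t * y) := by
    rw [add_comm]; exact Real.add_one_le_exp _
  have h2 := Real.rpow_le_rpow_of_nonpos hpos h1
    (show -(γ / t) / 2 ≤ 0 by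
      have : 0 < γ / t := by positivity
      linarith)
  rw [← Real.exp_mul] at h2
  have e : t * y * (-(γ / t) / 2) = -(γ * y) / 2 := by field_simp
  rwa [e] at h2

theorem denIntegrand_eq (γ : ℝ) (v : Fin N → ℝ) :
    denIntegrand γ N v = |vand v| ^ (2 * γ) * ∏ j, Real.exp (-(γ * v j ^ 2) / 2) := by
  rw [denIntegrand, ← Real.exp_sum]
  congr 2
  rw [← sum_div, sum_neg_distrib, mul_sum]

theorem denIntegrand_nonneg (γ : ℝ) (v : Fin N → ℝ) : 0 ≤ denIntegrand γ N v := by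
  unfold denIntegrand
  positivity

theorem continuous_denIntegrand {γ : ℝ} (hγ : 0 < γ) : Continuous (denIntegrand γ N) := by
  have h : denIntegrand γ N = fun v : Fin N → ℝ =>
      regVand γ 0 v * Real.exp (-(γ * ∑ j : Fin N, v j ^ 2) / 2) := by
    funext v
    rw [denIntegrand, regVand_zero]
  rw [h]
  exact (continuous_regVand hγ 0).mul (by fun_prop)

theorem integrable_denIntegrand {γ : ℝ} (hγ : 0 < γ) : Integrable (denIntegrand γ N) := by
  have hpos : 0 < 2 * γ * N + 4 := by positivity
  have ht : 0 < γ / (2 * γ * N + 4) := by positivity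
  have h := integrable_numIntegrand (N := N) hγ ht (by rw [div_div_cancel₀ hγ.ne'])
  refine h.norm.mono' (continuous_denIntegrand hγ).aestronglyMeasurable
    (Eventually.of_forall fun v => ?_)
  rw [norm_numIntegrand ht, Real.norm_of_nonneg (denIntegrand_nonneg γ v), denIntegrand_eq]
  gcongr
  exact exp_neg_le_one_add_rpow hγ ht (sq_nonneg _)

theorem integral_denIntegrand_pos {γ : ℝ} (hγ : 0 < γ) :
    0 < ∫ v : Fin N → ℝ, denIntegrand γ N v := by
  refine integral_pos_of_integrable_nonneg_nonzero (x := fun i : Fin N => (i : ℝ))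
    (continuous_denIntegrand hγ) (integrable_denIntegrand hγ) (denIntegrand_nonneg γ) ?_
  have hv : vand (fun i : Fin N => (i : ℝ)) ≠ 0 := by
    refine prod_ne_zero_iff.2 fun i _ => prod_ne_zero_iff.2 fun j hj => ?_
    have hij : i < j := mem_Ioi.1 hj
    exact sub_ne_zero.2 (Nat.cast_injective.ne (Fin.lt_def.1 hij).ne')
  have := abs_pos.2 hv
  unfold denIntegrand
  positivity

/-- In the Taylor expansion of the logarithm the linear term cancels the oscillating factor exactly
and the quadratic term is the Gaussian. The cubic remainder, multiplied by `γ / t`, is of order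
`√t`. -/
theorem tendsto_weight {γ : ℝ} (hγ : 0 < γ) (x : ℝ) :
    Tendsto (fun t : ℝ => weight (γ / t) (γ / t) (√t * x)) (𝓝[>] 0)
      (𝓝 (Real.exp (-(γ * x ^ 2) / 2) : ℂ)) := by
  have hsq : Tendsto (fun t : ℝ => √t) (𝓝[>] 0) (𝓝 0) := by
    have := (Real.continuous_sqrt.tendsto 0).mono_left (nhdsWithin_le_nhds (s := Set.Ioi (0 : ℝ)))
    simpa using this
  have hu : Tendsto (fun t : ℝ => √t * |x|) (𝓝[>] 0) (𝓝 0) := by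
    simpa using hsq.mul_const |x|
  have hbound : Tendsto (fun t : ℝ => γ * √t * |x| ^ 3 * (1 - √t * |x|)⁻¹ / 3) (𝓝[>] 0) (𝓝 0) := by
    have h1 := ((hsq.const_mul γ).mul_const (|x| ^ 3)).mul
      ((hu.const_sub 1).inv₀ (by norm_num))
    simpa using h1.div_const 3
  have hexp : Tendsto (fun t : ℝ => -(Complex.I * ((γ / t : ℝ) : ℂ) * ((√t * x : ℝ) : ℂ)) -
      ((γ / t : ℝ) : ℂ) * Complex.log (1 - Complex.I * ((√t * x : ℝ) : ℂ))) (𝓝[>] 0)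
      (𝓝 ((-(γ * x ^ 2) / 2 : ℝ) : ℂ)) := by
    rw [tendsto_iff_norm_sub_tendsto_zero]
    refine squeeze_zero' (Eventually.of_forall fun t => norm_nonneg _) ?_ hbound
    filter_upwards [self_mem_nhdsWithin, hu.eventually (gt_mem_nhds zero_lt_one)] with t ht hlt
    have ht : 0 < t := ht
    have hs : (0 : ℝ) < √t := Real.sqrt_pos.2 ht
    set z : ℂ := -(Complex.I * ((√t * x : ℝ) : ℂ)) with hz
    have hnz : ‖z‖ = √t * |x| := by
      rw [hz, norm_neg, norm_mul, Complex.norm_I, one_mul, Complex.norm_real, norm_mul,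
        Real.norm_of_nonneg hs.le, Real.norm_eq_abs]
    have h := Complex.norm_log_sub_logTaylor_le 2 (z := z) (by rw [hnz]; exact hlt)
    have hT : Complex.logTaylor 3 z = z - z ^ 2 / 2 := by
      simp [Complex.logTaylor, sum_range_succ]
      ring
    have hsqC : ((√t : ℝ) : ℂ) ^ 2 = (t : ℂ) := by
      rw [← Complex.ofReal_pow, Real.sq_sqrt ht.le]
    have htC : (t : ℂ) ≠ 0 := by exact_mod_cast ht.ne'
    have hz2 : z ^ 2 = -(t * x ^ 2) := by
      rw [hz, neg_sq, mul_pow, Complex.I_sq, ← hsqC]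
      push_cast
      ring
    rw [show (2 : ℕ) + 1 = 3 from rfl, hT, hz2, hnz] at h
    have e : -(Complex.I * ((γ / t : ℝ) : ℂ) * ((√t * x : ℝ) : ℂ)) -
      ((γ / t : ℝ) : ℂ) * Complex.log (1 - Complex.I * ((√t * x : ℝ) : ℂ)) -
        ((-(γ * x ^ 2) / 2 : ℝ) : ℂ) =
        -((γ / t : ℝ) : ℂ) * (Complex.log (1 + z) - (z - -(t * x ^ 2) / 2)) := by
      rw [show 1 - Complex.I * ((√t * x : ℝ) : ℂ) = 1 + z by rw [hz]; ring]
      rw [show -(Complex.I * ((γ / t : ℝ) : ℂ) * ((√t * x : ℝ) : ℂ)) = ((γ / t : ℝ) : ℂ) * z by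
        rw [hz]; ring]
      push_cast
      field_simp
      ring
    rw [e, norm_mul, norm_neg, Complex.norm_real, Real.norm_of_nonneg (by positivity)]
    refine (mul_le_mul_of_nonneg_left h (by positivity)).trans (le_of_eq ?_)
    have h3 : √t ^ 3 = t * √t := by
      rw [pow_succ, Real.sq_sqrt ht.le]
    rw [mul_pow, h3]
    push_cast
    field_simp
    norm_num
  have := (Complex.continuous_exp.tendsto _).comp hexp
  rw [← Complex.ofReal_exp] at this
  exact this

/-- The dominating function is the modulus at `t₀ = γ / (2γN + 4)`, the largest `t` with `γ / t`
above the integrability threshold. -/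
theorem tendsto_integral_numIntegrand {γ : ℝ} (hγ : 0 < γ) :
    Tendsto (fun t => ∫ v : Fin N → ℝ, numIntegrand γ N t v) (𝓝[>] 0)
      (𝓝 ((∫ v : Fin N → ℝ, denIntegrand γ N v : ℝ) : ℂ)) := by
  have hpos : 0 < 2 * γ * N + 4 := by positivity
  have ht₀ : 0 < γ / (2 * γ * N + 4) := by positivity
  have hmem := Ioc_mem_nhdsGT ht₀
  have hle : ∀ t ∈ Set.Ioc 0 (γ / (2 * γ * N + 4)), 2 * γ * N + 4 ≤ γ / t := by
    intro t ht
    rw [le_div_iff₀ ht.1, mul_comm, ← le_div_iff₀ hpos]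
    exact ht.2
  have hreal : ((∫ v : Fin N → ℝ, denIntegrand γ N v : ℝ) : ℂ) =
      ∫ v : Fin N → ℝ, (denIntegrand γ N v : ℂ) := integral_ofReal.symm
  rw [hreal]
  refine tendsto_integral_filter_of_dominated_convergence
    (fun v => ‖numIntegrand γ N (γ / (2 * γ * N + 4)) v‖) ?_ ?_
    (integrable_numIntegrand (N := N) hγ ht₀ (by rw [div_div_cancel₀ hγ.ne'])).norm
    (Eventually.of_forall fun v => ?_)
  · filter_upwards [hmem] with t ht
    exact (integrable_numIntegrand hγ ht.1 (hle t ht)).aestronglyMeasurable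
  · filter_upwards [hmem] with t ht
    refine Eventually.of_forall fun v => ?_
    rw [norm_numIntegrand ht.1, norm_numIntegrand ht₀]
    have htp := ht.1
    have : ∀ j, 0 ≤ (1 + t * v j ^ 2) ^ (-(γ / t) / 2) := fun j => by positivity
    exact mul_le_mul_of_nonneg_left (prod_le_prod (fun j _ => this j) fun j _ =>
      one_add_rpow_le hγ ht.1 ht.2 (sq_nonneg _)) (by positivity)
  · rw [denIntegrand_eq]
    push_cast
    have h := (tendsto_finsetProd univ fun j _ => tendsto_weight hγ (v j)).const_mul
      ((|vand v| ^ (2 * γ) : ℝ) : ℂ)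
    push_cast at h
    refine h.congr' ?_
    filter_upwards [self_mem_nhdsWithin] with t ht
    rw [numIntegrand]
    simp only [exp_mul_cpow_eq_weight (show 0 < t from ht)]

theorem tendsto_W {γ : ℝ} (hγ : 0 < γ) : Tendsto (W γ N) (𝓝[>] 0) (𝓝 1) := by
  have hne : ((∫ v : Fin N → ℝ, denIntegrand γ N v : ℝ) : ℂ) ≠ 0 := by
    exact_mod_cast (integral_denIntegrand_pos hγ).ne'
  have := (tendsto_integral_numIntegrand (N := N) hγ).div_const
    ((∫ v : Fin N → ℝ, denIntegrand γ N v : ℝ) : ℂ)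
  rwa [div_self hne] at this

/-- The difference equation for the normalized integral. -/
theorem W_div_add_one {γ s : ℝ} (hγ : 0 < γ) (hs : 2 * γ * N + 4 ≤ s) :
    W γ N (γ / (s + 1)) =
      (Real.exp (∑ j ∈ range N, stirlingIncrement (-(γ * j)) s) : ℂ) * W γ N (γ / s) := by
  have hs0 : 0 < s := lt_of_lt_of_le (by positivity) hs
  have hs1 : 0 < s + 1 := by linarith
  have hfac : ∀ j ∈ range N, 0 < s - γ * j := by
    intro j hj
    have h1 : (j : ℝ) ≤ N := by exact_mod_cast (mem_range.1 hj).le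
    have h2 : γ * j ≤ γ * N := by gcongr
    have h3 : 0 ≤ γ * N := by positivity
    linarith
  -- The passage from `(p, s) = (s, s)` to `(s + 1, s + 1)` goes through `(s, s + 1)`: `hZ1` moves
  -- the frequency and `hZ2` the exponent.
  have hZ1 := partitionFn_eq_exp_mul (N := N) (p := s) (p' := s + 1) (s := s + 1) hγ hs0 hs1 (by linarith)
  have hZ2 := pow_mul_partitionFn (N := N) (p := s) hγ hs
  have hlog : Real.log (s + 1) - Real.log s = Real.log (1 + 1 / s) := by
    rw [← Real.log_div hs1.ne' hs0.ne']
    congr 1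
    field_simp
  have hprod : (∏ j ∈ range N, ((s : ℂ) - γ * j)) =
      ((Real.exp (∑ j ∈ range N, Real.log (s - γ * j)) : ℝ) : ℂ) := by
    rw [Real.exp_sum, Complex.ofReal_prod]
    refine prod_congr rfl fun j hj => ?_
    rw [Real.exp_log (hfac j hj)]
    push_cast
    ring
  have hpow : (s : ℂ) ^ N = ((Real.exp (N * Real.log s) : ℝ) : ℂ) := by
    rw [Real.exp_nat_mul, Real.exp_log hs0]
    push_cast
    rfl
  have hroot : ∀ y : ℝ, 0 < y → √(γ / y) ^ (-(γ * (N * (N - 1)) + N)) =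
      Real.exp (-(γ * (N * (N - 1)) + N) / 2 * (Real.log γ - Real.log y)) := by
    intro y hy
    rw [Real.rpow_def_of_pos (Real.sqrt_pos.2 (by positivity)), Real.log_sqrt (by positivity),
      Real.log_div hγ.ne' hy.ne']
    congr 1
    ring
  have hgauss : ∀ M : ℕ, ∑ j ∈ range M, γ * (j : ℝ) = γ * (M * (M - 1)) / 2 := by
    intro M
    induction M with
    | zero => simp
    | succ M ih =>
      rw [sum_range_succ, ih]
      push_cast
      ring
  have hinc : ∑ j ∈ range N, stirlingIncrement (-(γ * j)) s =
      (N * (s + 1 / 2) - γ * (N * (N - 1)) / 2) * (Real.log (s + 1) - Real.log s) - N -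
        (∑ j ∈ range N, Real.log (s - γ * j) - N * Real.log s) := by
    have h1 : ∀ j ∈ range N, stirlingIncrement (-(γ * j)) s =
        ((s + 1 / 2) * (Real.log (s + 1) - Real.log s) - 1 + Real.log s) -
          (γ * j) * (Real.log (s + 1) - Real.log s) - Real.log (s - γ * j) := by
      intro j hj
      have h2 : 1 + -(γ * j) / s = (s - γ * j) / s := by field_simp; ring
      rw [stirlingIncrement, h2, Real.log_div (hfac j hj).ne' hs0.ne', hlog]
      ring
    rw [sum_congr rfl h1, sum_sub_distrib, sum_sub_distrib, ← sum_mul, hgauss, sum_const, card_range,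
      nsmul_eq_mul]
    ring
  have hZ3 : partitionFn N γ s (s + 1) =
      ((Real.exp (N * Real.log s - ∑ j ∈ range N, Real.log (s - γ * j)) : ℝ) : ℂ) *
        partitionFn N γ s s := by
    rw [hprod, hpow] at hZ2
    have hne : ((Real.exp (∑ j ∈ range N, Real.log (s - γ * j)) : ℝ) : ℂ) ≠ 0 := by
      exact_mod_cast (Real.exp_pos _).ne'
    apply mul_left_cancel₀ hne
    rw [← hZ2, ← mul_assoc, ← Complex.ofReal_mul, ← Real.exp_add]
    congr 4
    ring
  rw [W, W, integral_numIntegrand (by positivity), integral_numIntegrand (by positivity),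
    div_div_cancel₀ hγ.ne', div_div_cancel₀ hγ.ne', hZ1, hZ3, hroot _ hs1, hroot _ hs0, hinc,
    ← mul_div_assoc]
  congr 1
  simp only [← mul_assoc]
  rw [← Complex.ofReal_mul, ← Complex.ofReal_mul, ← Complex.ofReal_mul, ← Real.exp_add,
    ← Real.exp_add, ← Real.exp_add]
  congr 3
  ring

end NormalizedIntegral

/-! ### Uniqueness of expansions and the series for `log W` -/

section Expansion

open Finset Asymptotics

/-- At the first index `n` where the coefficients might differ, `(d n - c n) t ^ n` would be `O(t ^
(n+1))`. -/
theorem HasAsympExpansion.unique {f : ℝ → ℂ} {c d : ℕ → ℂ} (hc : HasAsympExpansion f c)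
    (hd : HasAsympExpansion f d) : c = d := by
  funext n
  induction n using Nat.strong_induction_on with
  | _ n ih =>
    have h := (hc (n + 1)).sub (hd (n + 1))
    have e : ∀ t : ℝ, f t - ∑ k ∈ range (n + 1), c k * (t : ℂ) ^ k -
        (f t - ∑ k ∈ range (n + 1), d k * (t : ℂ) ^ k) = (d n - c n) * (t : ℂ) ^ n := by
      intro t
      rw [sum_range_succ, sum_range_succ,
        sum_congr rfl fun k hk => by rw [ih k (mem_range.1 hk)]]
      ring
    simp only [e] at h
    obtain ⟨C, hC⟩ := h.bound
    have hle : ∀ᶠ t : ℝ in 𝓝[>] 0, ‖d n - c n‖ ≤ C * t := by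
      filter_upwards [hC, self_mem_nhdsWithin] with t ht ht0
      have ht0 : 0 < t := ht0
      rw [norm_mul, norm_pow, Complex.norm_real, norm_pow, Real.norm_of_nonneg ht0.le, pow_succ,
        ← mul_assoc, mul_right_comm] at ht
      exact le_of_mul_le_mul_right ht (pow_pos ht0 n)
    have hlim : Tendsto (fun t : ℝ => C * t) (𝓝[>] 0) (𝓝 0) := by
      have : Tendsto (fun t : ℝ => C * t) (𝓝 0) (𝓝 (C * 0)) := tendsto_id.const_mul C
      rw [mul_zero] at this
      exact this.mono_left nhdsWithin_le_nhds
    have h0 := ge_of_tendsto hlim hle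
    exact (sub_eq_zero.1 (norm_le_zero_iff.1 h0)).symm

theorem IsLogW.unique {γ : ℝ} {L M : PowerSeries (Polynomial ℂ)} (hL : IsLogW γ L)
    (hM : IsLogW γ M) : L = M := by
  ext1 k
  refine Polynomial.eq_of_infinite_eval_eq _ _ ?_
  refine Set.Infinite.mono (s := Set.range fun N : ℕ => ((N + 1 : ℕ) : ℂ)) ?_
    (Set.infinite_range_of_injective fun a b h => by
      have : a + 1 = b + 1 := Nat.cast_injective h
      omega)
  rintro _ ⟨N, rfl⟩
  exact congrFun ((hL (N + 1) (by omega)).unique (hM (N + 1) (by omega))) k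

theorem hasAsympExpansion_log_W {γ : ℝ} (hγ : 0 < γ) (N : ℕ) :
    HasAsympExpansion (fun t => Complex.log (W γ N t))
      (fun k => ((∑ j ∈ range N, stirlingCoeff (-(γ * j)) k / γ ^ k : ℝ) : ℂ)) := by
  have hinv : Tendsto (fun t : ℝ => γ / t) (𝓝[>] 0) atTop := by
    simpa only [div_eq_mul_inv] using tendsto_inv_nhdsGT_zero.const_mul_atTop hγ
  have hdiv : Tendsto (fun s : ℝ => γ / s) atTop (𝓝[>] 0) := by
    refine tendsto_nhdsWithin_iff.2 ⟨tendsto_const_nhds.div_atTop tendsto_id, ?_⟩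
    filter_upwards [eventually_gt_atTop 0] with s hs
    exact div_pos hγ hs
  have hlim : Tendsto (fun s => Complex.log (W γ N (γ / s))) atTop (𝓝 0) := by
    have h1 := (continuousAt_clog Complex.one_mem_slitPlane).tendsto.comp
      ((tendsto_W (N := N) hγ).comp hdiv)
    rw [Complex.log_one] at h1
    exact h1
  have hne : ∀ᶠ s : ℝ in atTop, W γ N (γ / s) ≠ 0 :=
    ((tendsto_W (N := N) hγ).comp hdiv).eventually_ne one_ne_zero
  -- The ratio is a positive real, so the principal logarithm is additive here with no multiple of
  -- `2πi`.
  have hrec : ∀ᶠ s : ℝ in atTop, Complex.log (W γ N (γ / (s + 1))) = Complex.log (W γ N (γ / s)) +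
      ((∑ j ∈ range N, stirlingIncrement (-(γ * j)) s : ℝ) : ℂ) := by
    filter_upwards [hne, eventually_ge_atTop (2 * γ * N + 4)] with s hs hs'
    rw [W_div_add_one hγ hs', Complex.log_ofReal_mul (Real.exp_pos _) hs, Real.log_exp, add_comm]
  intro n
  have h := (isBigO_sub_sum_stirlingCoeff hlim (range N) (fun j => -(γ * j)) hrec n).comp_tendsto hinv
  have h2 : (fun t : ℝ => (γ / t)⁻¹ ^ n) =O[𝓝[>] (0 : ℝ)] fun t => t ^ n := by
    refine IsBigO.of_bound ‖(γ ^ n)⁻¹‖ (Eventually.of_forall fun t => ?_)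
    rw [inv_div, div_pow, div_eq_inv_mul, norm_mul]
  refine (h.trans h2).congr' ?_ EventuallyEq.rfl
  filter_upwards [self_mem_nhdsWithin] with t ht
  have ht : t ≠ 0 := (show 0 < t from ht).ne'
  simp only [Function.comp_apply, div_div_cancel₀ hγ.ne']
  congr 1
  push_cast
  refine sum_congr rfl fun k _ => ?_
  rw [inv_div, div_pow, ← sum_div]
  ring

/-- The explicit series for `log W`. -/
noncomputable def logWSeries (γ : ℝ) : PowerSeries (Polynomial ℂ) :=
  -(PowerSeries.C (Polynomial.C (γ : ℂ) * Polynomial.X)) *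
    PowerSeries.mk (fun n : ℕ =>
      if Odd n then
        Polynomial.C ((bernoulli (n + 1) : ℂ) / (((n : ℂ) + 1) * (n : ℂ)))
      else 0)
  + PowerSeries.mk (fun δ : ℕ =>
      if 1 ≤ δ then
        Polynomial.C (1 / ((δ : ℂ) * ((δ : ℂ) + 1))) *
          ∑ r ∈ Finset.Icc 1 (δ + 1),
            Polynomial.C (((δ + 1).choose r : ℂ) * (bernoulli (δ + 1 - r) : ℂ)) *
              (Polynomial.C ((-1 : ℂ) ^ (δ + 1 - r) / (γ : ℂ) ^ ((δ : ℤ) - (r : ℤ))) *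
                  Polynomial.X ^ r
                - ∑ m ∈ Finset.Icc 1 (r + 1),
                    Polynomial.C
                      (((r + 1).choose m : ℂ) *
                        ((bernoulli (r + 1 - m) : ℂ) / ((r : ℂ) + 1)) *
                        (1 / (γ : ℂ) ^ ((r : ℤ) - (m : ℤ))) *
                        (-1 : ℂ) ^ ((δ : ℤ) - (m : ℤ))) *
                      Polynomial.X ^ m)
      else 0)

theorem eval_coeff_logWSeries (γ : ℝ) (δ : ℕ) (x : ℂ) :
    (PowerSeries.coeff δ (logWSeries γ)).eval x = logWCoeff γ δ x := by
  rw [logWSeries, map_add, neg_mul, map_neg, PowerSeries.coeff_C_mul, PowerSeries.coeff_mk,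
    PowerSeries.coeff_mk, Polynomial.eval_add, Polynomial.eval_neg, Polynomial.eval_mul, logWCoeff,
    neg_mul]
  congr 1
  · congr 1
    split_ifs <;> simp
  · split_ifs with h
    · simp [Polynomial.eval_finsetSum]
    -- `logWCoeff` has no case distinction at `δ = 0`; there its prefactor `1 / (0 * 1)` is `0`.
    · obtain rfl : δ = 0 := by omega
      simp

theorem logWCoeff_natCast_eq_sum_stirlingCoeff {γ : ℝ} (hγ : 0 < γ) (δ N : ℕ) :
    logWCoeff γ δ N = ((∑ j ∈ range N, stirlingCoeff (-(γ * j)) δ / γ ^ δ : ℝ) : ℂ) := by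
  rcases Nat.eq_zero_or_pos δ with rfl | hδ
  · simp [logWCoeff, stirlingCoeff_zero]
  · rw [logWCoeff_natCast _ (by exact_mod_cast hγ.ne') δ hδ, Complex.ofReal_sum, mul_sum]
    refine sum_congr rfl fun j _ => ?_
    have e : Polynomial.aeval (-((γ : ℂ) * j)) (Polynomial.bernoulli (δ + 1)) =
        ((Polynomial.aeval (-(γ * j)) (Polynomial.bernoulli (δ + 1)) : ℝ) : ℂ) := by
      have := Polynomial.aeval_algebraMap_apply ℂ (-(γ * j)) (Polynomial.bernoulli (δ + 1))
      simpa using this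
    rw [e, stirlingCoeff]
    push_cast
    ring

theorem isLogW_logWSeries {γ : ℝ} (hγ : 0 < γ) : IsLogW γ (logWSeries γ) := by
  intro N _
  simp only [eval_coeff_logWSeries, logWCoeff_natCast_eq_sum_stirlingCoeff hγ]
  exact hasAsympExpansion_log_W hγ N

theorem eventually_integrable_numIntegrand {γ : ℝ} (hγ : 0 < γ) (N : ℕ) :
    ∀ᶠ t in 𝓝[>] (0 : ℝ), Integrable (numIntegrand γ N t) := by
  have hpos : 0 < 2 * γ * N + 4 := by positivity
  filter_upwards [Ioc_mem_nhdsGT (show 0 < γ / (2 * γ * N + 4) by positivity)] with t ht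
  refine integrable_numIntegrand hγ ht.1 ?_
  rw [le_div_iff₀ ht.1, mul_comm, ← le_div_iff₀ hpos]
  exact ht.2

end Expansion

end BetaEnsemble

theorem theorem4p2 (γ : ℝ) (hγ : 0 < γ) :
    (∀ N : ℕ, 1 ≤ N →
      Integrable (BetaEnsemble.denIntegrand γ N) ∧
      (0 < ∫ v : Fin N → ℝ, BetaEnsemble.denIntegrand γ N v) ∧
      ∀ᶠ t in 𝓝[>] (0 : ℝ),
        Integrable (BetaEnsemble.numIntegrand γ N t) ∧ BetaEnsemble.W γ N t ≠ 0) ∧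
    ∀ L : PowerSeries (Polynomial ℂ),
      BetaEnsemble.IsLogW γ L ↔
        L =
          -- `-γ x ∑_{k ≥ 1} B_{2k} t^{2k-1} / (2k (2k-1))`, with `n = 2k - 1`
          -(PowerSeries.C (Polynomial.C (γ : ℂ) * Polynomial.X)) *
            PowerSeries.mk (fun n : ℕ =>
              if Odd n then
                Polynomial.C ((bernoulli (n + 1) : ℂ) / (((n : ℂ) + 1) * (n : ℂ)))
              else 0)
          + PowerSeries.mk (fun δ : ℕ =>
              if 1 ≤ δ then
                Polynomial.C (1 / ((δ : ℂ) * ((δ : ℂ) + 1))) *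
                  ∑ r ∈ Finset.Icc 1 (δ + 1),
                    Polynomial.C (((δ + 1).choose r : ℂ) * (bernoulli (δ + 1 - r) : ℂ)) *
                      (Polynomial.C ((-1 : ℂ) ^ (δ + 1 - r) / (γ : ℂ) ^ ((δ : ℤ) - (r : ℤ))) *
                          Polynomial.X ^ r
                        - ∑ m ∈ Finset.Icc 1 (r + 1),
                            Polynomial.C
                              (((r + 1).choose m : ℂ) *
                                ((bernoulli (r + 1 - m) : ℂ) / ((r : ℂ) + 1)) *
                                (1 / (γ : ℂ) ^ ((r : ℤ) - (m : ℤ))) *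
                                (-1 : ℂ) ^ ((δ : ℤ) - (m : ℤ))) *
                              Polynomial.X ^ m)
              else 0) := by
  refine ⟨fun N _ => ⟨BetaEnsemble.integrable_denIntegrand hγ,
    BetaEnsemble.integral_denIntegrand_pos hγ,
    (BetaEnsemble.eventually_integrable_numIntegrand hγ N).and
      ((BetaEnsemble.tendsto_W hγ).eventually_ne one_ne_zero)⟩, fun L => ?_⟩
  exact ⟨fun h => h.unique (BetaEnsemble.isLogW_logWSeries hγ),
    fun h => h ▸ BetaEnsemble.isLogW_logWSeries hγ⟩
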